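/- Theorem. For $x\in\mathbb R^3$ write $\langle x\rangle=\sqrt{1+|x|^2}$; let $\sigma=(\sigma_1,\sigma_2,\sigma_3)$ be the Pauli matrices $$\sigma_1=\begin{pmatrix}0&1\\1&0\end{pmatrix},\quad \sigma_2=\begin{pmatrix}0&-i\\i&0\end{pmatrix},\quad \sigma_3=\begin{pmatrix}1&0\\0&-1\end{pmatrix},$$ $\sigma\cdot v=\sum_j v_j\sigma_j$, $I_2$ the $2\times2$ identity matrix, and $D=\frac1i\nabla$. Let $A:\mathbb R^3\to\mathbb R^3$ be measurable with $$|A(x)|\le C\langle x\rangle^{-\rho}\qquad(x\in\mathbb R^3)$$ for some constants $C>0$ and $\rho>1$, and let $\psi$ be a zero mode of the Weyl–Dirac operator $\sigma\cdot(D-A(x))$, that is, $\psi\in[H^1(\mathbb R^3)]^2$ and $\sigma\cdot(D-A)\psi=0$ in $[L^2(\mathbb R^3)]^2$, with derivatives in the sense of distributions. Then $\psi$ has a continuous representative, again denoted by $\psi$; for every unit vector $\omega\in\mathbb S^2$ the function $y\mapsto\{(\omega\cdot A(y))I_2+i\sigma\cdot(\omega\times A(y))\}\psi(y)$ is integrable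 on $\mathbb R^3$; and $$\lim_{r\to+\infty}r^2\psi(r\omega)=\frac{i}{4\pi}\int_{\mathbb R^3}\big\{(\omega\cdot A(y))\,I_2+i\,\sigma\cdot(\omega\times A(y))\big\}\,\psi(y)\,dy ,$$ the convergence being uniform with respect to $\omega\in\mathbb S^2$. -/

import Mathlib

open MeasureTheory Filter Topology TemperedDistribution
open scoped SchwartzMap LineDeriv Matrix

noncomputable section

namespace WeylDirac

/-- Euclidean space `ℝ³`. -/
abbrev Space : Type := EuclideanSpace ℝ (Fin 3)

/-- Two-component spinors, `ℂ²` with its Hermitian norm. -/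
abbrev Spinor : Type := EuclideanSpace ℂ (Fin 2)

/-- The Japanese bracket `⟨x⟩ = √(1 + |x|²)`. -/
def bracket (x : Space) : ℝ := Real.sqrt (1 + ‖x‖ ^ 2)

/-- The Pauli matrices `σ₁, σ₂, σ₃` (indexed by `0, 1, 2`). -/
def pauli : Fin 3 → Matrix (Fin 2) (Fin 2) ℂ :=
  ![!![0, 1; 1, 0], !![0, -Complex.I; Complex.I, 0], !![1, 0; 0, -1]]

/-- The matrix `σ · v = v₁ σ₁ + v₂ σ₂ + v₃ σ₃` of a real three-vector `v`. -/
def pauliDot (v : Fin 3 → ℝ) : Matrix (Fin 2) (Fin 2) ℂ :=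
  ∑ j, (v j : ℂ) • pauli j

/-- The action of a `2 × 2` matrix on a spinor. -/
def act (M : Matrix (Fin 2) (Fin 2) ℂ) (v : Spinor) : Spinor :=
  WithLp.toLp 2 (M *ᵥ v.ofLp)

/-- The `j`-th standard unit vector of `ℝ³`. -/
def unitVec (j : Fin 3) : Space := EuclideanSpace.single j 1

/-- `ψ` is a zero mode of the Weyl–Dirac operator `σ · (D - A)`, `D = -i ∇`, whose domain is
`[H¹(ℝ³)]²`: `ψ` belongs to `[H¹(ℝ³)]²`, and `∑ⱼ σⱼ (Dⱼ ψ - Aⱼ ψ) = 0` in `[L²(ℝ³)]²`. Here `P j` is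
the square-integrable function `Dⱼ ψ = -i ∂ⱼ ψ`, the derivative being that of distributions. -/
def IsZeroMode (A : Space → Space) (ψ : Lp Spinor 2 (volume : Measure Space)) : Prop :=
  MemSobolev 1 2 (ψ : 𝓢'(Space, Spinor)) ∧
    ∃ P : Fin 3 → Lp Spinor 2 (volume : Measure Space),
      (∀ j, (-Complex.I) • ∂_{unitVec j} (ψ : 𝓢'(Space, Spinor)) = (P j : 𝓢'(Space, Spinor))) ∧
      ∀ᵐ x : Space, ∑ j, act (pauli j) (P j x - ((A x j : ℝ) : ℂ) • ψ x) = 0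

/-- The matrix `(ω · a) I₂ + i σ · (ω × a)`. -/
def limitMatrix (ω a : Space) : Matrix (Fin 2) (Fin 2) ℂ :=
  ((inner ℝ ω a : ℝ) : ℂ) • (1 : Matrix (Fin 2) (Fin 2) ℂ) +
    Complex.I • pauliDot (ω.ofLp ⨯₃ a.ofLp)

end WeylDirac

end

open scoped ENNReal NNReal

noncomputable section

namespace WeylDirac

/-! Since `(σ·∇)² = Δ`, the operator `σ·D` has Green kernel `(i/4π) σ·z/|z|³`, so a zero mode should
satisfy `ψ(x) = (i/4π) ∫ σ·(x-y)/|x-y|³ (σ·A)ψ(y) dy`. If the source `(σ·A)ψ` decays faster than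
`⟨y⟩⁻³`, this integral is continuous in `x`. As `r² z/|z|³ → ω` for `z = rω - y`, the limit is
`(i/4π) ∫ (σ·ω)(σ·A)ψ`, and `(σ·ω)(σ·a) = (ω·a) + iσ·(ω×a)`.

The representation (`IsZeroMode.ae_eq_integral`) comes from testing the equation against `σ·z
κ(|z|²)`, `z = x-y`, with `κ` a smooth annular truncation of `t^(-3/2)`. The derivative matrix of
this radial field is symmetric, so only its divergence survives the Pauli algebra. This divergence
is `4π` times the difference of two mollifiers: the narrow one recovers `ψ(x)` at Lebesgue points,
the wide one vanishes in the limit because `ψ` is in `L²`.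

For the decay, `u = |ψ|` satisfies `u ≤ c ∫ |x-y|⁻² ⟨y⟩^(-ρ) u(y) dy`. One iteration of the kernel
makes it square-integrable, so `u` is bounded; then each pass through the inequality improves the
decay by a fixed amount, up to `⟨x⟩⁻²` (`exists_ae_le_weight_two`). The source is then
`O(⟨y⟩^(-ρ-2))`, with `ρ + 2 > 3`. -/

lemma one_le_bracket (x : Space) : 1 ≤ bracket x := by
  unfold bracket
  rw [Real.one_le_sqrt]
  nlinarith [sq_nonneg ‖x‖]

lemma bracket_pos (x : Space) : 0 < bracket x := zero_lt_one.trans_le (one_le_bracket x)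

lemma bracket_sq (x : Space) : bracket x ^ 2 = 1 + ‖x‖ ^ 2 :=
  Real.sq_sqrt (by positivity)

lemma norm_le_bracket (x : Space) : ‖x‖ ≤ bracket x :=
  Real.le_sqrt_of_sq_le (by linarith)

lemma continuous_bracket : Continuous bracket := by
  unfold bracket; fun_prop

lemma bracket_le_norm_sub_add (x y : Space) : bracket x ≤ ‖x - y‖ + bracket y := by
  have h1 : ‖x‖ ≤ ‖x - y‖ + ‖y‖ := by simpa using norm_add_le (x - y) y
  have h2 := norm_le_bracket y
  have h3 := bracket_pos y
  refine Real.sqrt_le_iff.2 ⟨by positivity, ?_⟩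
  nlinarith [bracket_sq y, norm_nonneg (x - y), norm_nonneg x, norm_nonneg y]

lemma bracket_le_two_mul_norm {x : Space} (hx : 1 ≤ ‖x‖) : bracket x ≤ 2 * ‖x‖ :=
  Real.sqrt_le_iff.2 ⟨by positivity, by nlinarith⟩

/-! ### Riesz kernels against polynomial weights. -/

/-- The Riesz kernel `|z|⁻ᵃ`. -/
def riesz (a : ℝ) (z : Space) : ℝ≥0∞ := ENNReal.ofReal (‖z‖ ^ (-a))

/-- The polynomial weight `⟨y⟩⁻ᵇ`. -/
def weight (b : ℝ) (y : Space) : ℝ≥0∞ := ENNReal.ofReal (bracket y ^ (-b))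

@[fun_prop]
lemma measurable_riesz (a : ℝ) : Measurable (riesz a) := by
  unfold riesz; fun_prop

@[fun_prop]
lemma measurable_weight (b : ℝ) : Measurable (weight b) := by
  have := continuous_bracket.measurable
  unfold weight; fun_prop

lemma riesz_neg (a : ℝ) (z : Space) : riesz a (-z) = riesz a z := by simp [riesz]

lemma riesz_sub_comm (a : ℝ) (x y : Space) : riesz a (x - y) = riesz a (y - x) := by
  rw [← riesz_neg, neg_sub]

lemma weight_zero (y : Space) : weight 0 y = 1 := by simp [weight]

lemma weight_ne_zero (b : ℝ) (y : Space) : weight b y ≠ 0 := by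
  simpa [weight] using Real.rpow_pos_of_pos (bracket_pos y) _

lemma weight_mul_weight (a b : ℝ) (y : Space) : weight a y * weight b y = weight (a + b) y := by
  rw [weight, weight, weight, ← ENNReal.ofReal_mul (Real.rpow_nonneg (bracket_pos y).le _),
    ← Real.rpow_add (bracket_pos y), neg_add]

lemma weight_anti {a b : ℝ} (h : a ≤ b) (y : Space) : weight b y ≤ weight a y :=
  ENNReal.ofReal_le_ofReal
    (Real.rpow_le_rpow_of_exponent_le (one_le_bracket y) (neg_le_neg h))

lemma riesz_mul_self (a : ℝ) (z : Space) : riesz a z * riesz a z = riesz (2 * a) z := by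
  rw [riesz, riesz, ← ENNReal.ofReal_mul (by positivity)]
  congr 1
  rcases (norm_nonneg z).eq_or_lt with h | h
  · rw [← h]
    rcases eq_or_ne a 0 with rfl | ha
    · simp
    · rw [Real.zero_rpow (by simpa), Real.zero_rpow (by simpa)]; simp
  · rw [← Real.rpow_add h]; ring_nf

lemma lintegral_weight_lt_top {b : ℝ} (hb : 3 < b) : ∫⁻ y, weight b y < ⊤ := by
  have h : Integrable (fun y : Space => (1 + ‖y‖ ^ 2) ^ (-b / 2)) :=
    integrable_rpow_neg_one_add_norm_sq (by simpa using hb)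
  have h2 := h.lintegral_lt_top
  refine lt_of_eq_of_lt (lintegral_congr fun y => ?_) h2
  rw [weight, bracket, Real.sqrt_eq_rpow, ← Real.rpow_mul (by positivity)]
  ring_nf

lemma lintegral_ball_riesz_lt_top {a : ℝ} (ha : a < 3) :
    ∫⁻ z, (Metric.ball (0 : Space) 1).indicator (riesz a) z < ⊤ := by
  rw [lintegral_indicator Metric.isOpen_ball.measurableSet]
  have h : IntegrableOn (fun z : Space => ‖z‖ ^ (-a)) (Metric.ball 0 1) volume := by
    rw [integrableOn_fun_norm_addHaar volume (f := fun t => t ^ (-a))]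
    have h2 : IntegrableOn (fun t : ℝ => t ^ (2 - a)) (Set.Ioo 0 1) :=
      (intervalIntegral.integrableOn_Ioo_rpow_iff one_pos).2 (by linarith)
    refine h2.congr_fun (fun t ht => ?_) measurableSet_Ioo
    simp only [finrank_euclideanSpace, Fintype.card_fin, Nat.add_one_sub_one, smul_eq_mul]
    rw [sub_eq_add_neg, Real.rpow_add ht.1]
    norm_num
  exact h.lintegral_lt_top

/-- Near the origin the weight is at most `1`. Away from it `|z|` is comparable to `⟨z⟩`, and a
product of two weights is controlled by the total power at the point with the smaller bracket. Each
term is then integrable in `y` uniformly under `z = x - y`. -/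
lemma riesz_mul_weight_le {a b : ℝ} (ha : 0 ≤ a) (hb : 0 ≤ b) (z y : Space) :
    riesz a z * weight b y ≤ (Metric.ball (0 : Space) 1).indicator (riesz a) z +
      ENNReal.ofReal (2 ^ a) * (weight (a + b) z + weight (a + b) y) := by
  by_cases hz : ‖z‖ < 1
  · refine le_add_right ?_
    rw [Set.indicator_of_mem (by simpa using hz)]
    calc riesz a z * weight b y ≤ riesz a z * weight 0 y := by gcongr; exact weight_anti hb y
      _ = riesz a z := by rw [weight_zero, mul_one]
  · refine le_add_left ?_
    have hz' : 1 ≤ ‖z‖ := not_lt.1 hz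
    have h1 : riesz a z ≤ ENNReal.ofReal (2 ^ a) * weight a z := by
      rw [riesz, weight, ← ENNReal.ofReal_mul (by positivity)]
      refine ENNReal.ofReal_le_ofReal ?_
      have h2 : bracket z / 2 ≤ ‖z‖ := by linarith [bracket_le_two_mul_norm hz']
      calc ‖z‖ ^ (-a) ≤ (bracket z / 2) ^ (-a) :=
            Real.rpow_le_rpow_of_nonpos (by have := bracket_pos z; positivity) h2 (by linarith)
        _ = 2 ^ a * bracket z ^ (-a) := by
            rw [Real.div_rpow (bracket_pos z).le (by norm_num), Real.rpow_neg two_pos.le,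
              div_inv_eq_mul, mul_comm]
    calc riesz a z * weight b y ≤ ENNReal.ofReal (2 ^ a) * weight a z * weight b y := by gcongr
      _ = ENNReal.ofReal (2 ^ a) * (weight a z * weight b y) := mul_assoc _ _ _
      _ ≤ _ := by
        gcongr
        rcases le_total (bracket z) (bracket y) with h | h
        · refine le_add_right ?_
          rw [← weight_mul_weight]
          gcongr
          exact ENNReal.ofReal_le_ofReal
            (Real.rpow_le_rpow_of_nonpos (bracket_pos z) h (by linarith))
        · refine le_add_left ?_
          rw [← weight_mul_weight]
          gcongr
          exact ENNReal.ofReal_le_ofReal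
            (Real.rpow_le_rpow_of_nonpos (bracket_pos y) h (by linarith))

/-- The Riesz potential of a polynomial weight is bounded in the supercritical range. -/
lemma exists_lintegral_riesz_mul_weight_le {a b : ℝ} (ha : 0 ≤ a) (ha3 : a < 3) (hb : 0 ≤ b)
    (hab : 3 < a + b) :
    ∃ M : ℝ≥0, ∀ x, ∫⁻ y, riesz a (x - y) * weight b y ≤ M := by
  set K : ℝ≥0∞ := (∫⁻ z, (Metric.ball (0 : Space) 1).indicator (riesz a) z) +
    ENNReal.ofReal (2 ^ a) * (∫⁻ z, weight (a + b) z + weight (a + b) z) with hK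
  have hK_top : K ≠ ⊤ := by
    have h1 := (lintegral_ball_riesz_lt_top ha3).ne
    have h2 := (lintegral_weight_lt_top hab).ne
    rw [hK, lintegral_add_left (by fun_prop)]
    finiteness
  refine ⟨K.toNNReal, fun x => ?_⟩
  rw [ENNReal.coe_toNNReal hK_top, hK]
  have hm : Measurable ((Metric.ball (0 : Space) 1).indicator (riesz a)) :=
    (measurable_riesz a).indicator Metric.isOpen_ball.measurableSet
  refine (lintegral_mono fun y => riesz_mul_weight_le ha hb (x - y) y).trans ?_
  rw [lintegral_add_left (by fun_prop), lintegral_const_mul _ (by fun_prop),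
    lintegral_add_left (by fun_prop), lintegral_add_left (by fun_prop),
    lintegral_sub_left_eq_self (fun z => (Metric.ball (0 : Space) 1).indicator (riesz a) z),
    lintegral_sub_left_eq_self (fun z => weight (a + b) z)]

lemma add_rpow_le_two_rpow_mul {s p q : ℝ} (hs : 0 ≤ s) (hp : 0 ≤ p) (hq : 0 ≤ q) :
    (p + q) ^ s ≤ 2 ^ s * (p ^ s + q ^ s) := by
  have h : (p + q) ^ s ≤ (2 * max p q) ^ s :=
    Real.rpow_le_rpow (by positivity)
      (by linarith [le_max_left p q, le_max_right p q]) hs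
  refine h.trans ?_
  rw [Real.mul_rpow two_pos.le (le_max_of_le_left hp)]
  gcongr
  rcases max_choice p q with h | h <;> rw [h]
  · linarith [Real.rpow_nonneg hq s]
  · linarith [Real.rpow_nonneg hp s]

/-- The inequality `⟨x⟩ ≤ |x-y| + ⟨y⟩`, raised to the power `s`, buys decay in `x` at the cost of
either the kernel's or the weight's exponent. -/
lemma riesz_two_mul_weight_le {b s : ℝ} (hs : 0 ≤ s) {x y : Space} (hxy : x ≠ y) :
    riesz 2 (x - y) * weight b y ≤ ENNReal.ofReal (2 ^ s) *
      (riesz (2 - s) (x - y) * weight b y + riesz 2 (x - y) * weight (b - s) y) * weight s x := by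
  have hd : 0 < ‖x - y‖ := norm_pos_iff.2 (sub_ne_zero.2 hxy)
  have hx := bracket_pos x
  have hy := bracket_pos y
  simp only [riesz, weight]
  rw [← ENNReal.ofReal_mul (by positivity), ← ENNReal.ofReal_mul (by positivity),
    ← ENNReal.ofReal_mul (by positivity), ← ENNReal.ofReal_add (by positivity) (by positivity),
    ← ENNReal.ofReal_mul (by positivity), ← ENNReal.ofReal_mul (by positivity)]
  refine ENNReal.ofReal_le_ofReal ?_
  have h1 : bracket x ^ s ≤ 2 ^ s * (‖x - y‖ ^ s + bracket y ^ s) :=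
    (Real.rpow_le_rpow hx.le (bracket_le_norm_sub_add x y) hs).trans
      (add_rpow_le_two_rpow_mul hs hd.le hy.le)
  have h2 : ‖x - y‖ ^ (-(2 - s)) = ‖x - y‖ ^ (-2 : ℝ) * ‖x - y‖ ^ s := by
    rw [← Real.rpow_add hd]; ring_nf
  have h3 : bracket y ^ (-(b - s)) = bracket y ^ (-b) * bracket y ^ s := by
    rw [← Real.rpow_add hy]; ring_nf
  rw [h2, h3, Real.rpow_neg hx.le s, ← div_eq_mul_inv, le_div_iff₀ (by positivity)]
  calc _ ≤ ‖x - y‖ ^ (-2 : ℝ) * bracket y ^ (-b) * (2 ^ s * (‖x - y‖ ^ s + bracket y ^ s)) := by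
        gcongr
    _ = _ := by ring

lemma ae_ne_space (x : Space) : ∀ᵐ y : Space, x ≠ y := by
  have : ∀ᵐ y : Space, y ∈ ({x}ᶜ : Set Space) := compl_mem_ae_iff.2 (by simp)
  filter_upwards [this] with y hy h
  exact hy h.symm

/-- Decay of the Riesz potential of order one of a polynomial weight. -/
lemma exists_lintegral_riesz_two_mul_weight_le {b s : ℝ} (hs : 0 ≤ s) (hs2 : s ≤ 2)
    (hb : s + 1 < b) :
    ∃ M : ℝ≥0, ∀ x, ∫⁻ y, riesz 2 (x - y) * weight b y ≤ M * weight s x := by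
  obtain ⟨M₁, h₁⟩ := exists_lintegral_riesz_mul_weight_le (a := 2 - s) (b := b) (by linarith)
    (by linarith) (by linarith) (by linarith)
  obtain ⟨M₂, h₂⟩ := exists_lintegral_riesz_mul_weight_le (a := 2) (b := b - s) (by linarith)
    (by linarith) (by linarith) (by linarith)
  refine ⟨(2 ^ s : ℝ).toNNReal * (M₁ + M₂), fun x => ?_⟩
  refine (lintegral_mono_ae ((ae_ne_space x).mono fun y hy =>
    riesz_two_mul_weight_le (b := b) hs hy)).trans ?_
  rw [lintegral_mul_const _ (by fun_prop), lintegral_const_mul _ (by fun_prop),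
    lintegral_add_left (by fun_prop)]
  push_cast
  have := h₁ x
  have := h₂ x
  rw [ENNReal.ofReal]
  gcongr

/-- The longer of the two legs from `z` is at least `|x-y|/2`; `s` of its powers go to `|x-y|`, and
the remaining `2-s` are bounded by the shorter leg. -/
lemma riesz_two_mul_riesz_two_le {s : ℝ} (hs : 0 ≤ s) (hs2 : s ≤ 2) {x y : Space} (hxy : x ≠ y)
    (z : Space) :
    riesz 2 (x - z) * riesz 2 (z - y) ≤ ENNReal.ofReal (2 ^ s) * riesz s (x - y) *
      (riesz (4 - s) (x - z) + riesz (4 - s) (y - z)) := by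
  -- On the diagonals the left side is `0`, because `0 ^ (-2) = 0` for real powers.
  rcases eq_or_ne x z with rfl | hxz
  · simp [riesz]
  rcases eq_or_ne y z with rfl | hyz
  · simp [riesz]
  rw [riesz_sub_comm 2 z y]
  have hd : 0 < ‖x - y‖ := norm_pos_iff.2 (sub_ne_zero.2 hxy)
  have hp : 0 < ‖x - z‖ := norm_pos_iff.2 (sub_ne_zero.2 hxz)
  have hq : 0 < ‖y - z‖ := norm_pos_iff.2 (sub_ne_zero.2 hyz)
  have htri : ‖x - y‖ ≤ ‖x - z‖ + ‖y - z‖ := by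
    simpa using norm_sub_le (x - z) (y - z)
  have key : ∀ p q : ℝ, 0 < p → 0 < q → p ≤ q → ‖x - y‖ ≤ p + q →
      p ^ (-2 : ℝ) * q ^ (-2 : ℝ) ≤ 2 ^ s * ‖x - y‖ ^ (-s) * p ^ (-(4 - s)) := by
    intro p q hp hq hpq h
    have h1 : q ^ (-s) ≤ 2 ^ s * ‖x - y‖ ^ (-s) := by
      calc q ^ (-s) ≤ (‖x - y‖ / 2) ^ (-s) :=
            Real.rpow_le_rpow_of_nonpos (by positivity) (by linarith) (by linarith)
        _ = _ := by
            rw [Real.div_rpow hd.le (by norm_num), Real.rpow_neg two_pos.le,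
              div_inv_eq_mul, mul_comm]
    have h2 : q ^ (-(2 - s)) ≤ p ^ (-(2 - s)) :=
      Real.rpow_le_rpow_of_nonpos hp hpq (by linarith)
    have h3 : q ^ (-2 : ℝ) = q ^ (-s) * q ^ (-(2 - s)) := by
      rw [← Real.rpow_add hq]; ring_nf
    have h4 : p ^ (-(4 - s)) = p ^ (-2 : ℝ) * p ^ (-(2 - s)) := by
      rw [← Real.rpow_add hp]; ring_nf
    rw [h3, h4]
    calc p ^ (-2 : ℝ) * (q ^ (-s) * q ^ (-(2 - s)))
        ≤ p ^ (-2 : ℝ) * (2 ^ s * ‖x - y‖ ^ (-s) * p ^ (-(2 - s))) := by gcongr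
      _ = _ := by ring
  simp only [riesz]
  rw [← ENNReal.ofReal_mul (by positivity), ← ENNReal.ofReal_mul (by positivity),
    ← ENNReal.ofReal_add (by positivity) (by positivity), ← ENNReal.ofReal_mul (by positivity)]
  refine ENNReal.ofReal_le_ofReal ?_
  have hn1 : 0 ≤ 2 ^ s * ‖x - y‖ ^ (-s) * ‖x - z‖ ^ (-(4 - s)) := by positivity
  have hn2 : 0 ≤ 2 ^ s * ‖x - y‖ ^ (-s) * ‖y - z‖ ^ (-(4 - s)) := by positivity
  rw [mul_add]
  rcases le_total ‖x - z‖ ‖y - z‖ with h | h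
  · linarith [key _ _ hp hq h htri]
  · rw [mul_comm (‖x - z‖ ^ (-2 : ℝ))]
    linarith [key _ _ hq hp h (by linarith)]

/-! ### Square-integrable subsolutions of the Riesz inequality. -/

lemma lintegral_weight_mul_lt_top {u : Space → ℝ≥0∞}
    (hu2 : ∫⁻ y, u y * u y < ⊤) {b : ℝ} (hb : 3 < 2 * b) :
    ∫⁻ y, weight b y * u y < ⊤ := by
  have h : ∀ y, weight b y * u y ≤ weight (2 * b) y + u y * u y := by
    intro y
    rw [two_mul, ← weight_mul_weight]
    rcases le_total (weight b y) (u y) with h | h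
    · exact le_add_left (by gcongr)
    · exact le_add_right (by gcongr)
  refine (lintegral_mono h).trans_lt ?_
  rw [lintegral_add_left (by fun_prop)]
  exact ENNReal.add_lt_top.2 ⟨lintegral_weight_lt_top hb, hu2⟩

/-- Integrate against the positive weight `⟨x⟩⁻⁴` and swap the integrals: the inner one is
`O(⟨y⟩⁻²)`, which is square-integrable and so pairs with `u`. -/
lemma ae_lintegral_riesz_two_lt_top {u : Space → ℝ≥0∞} (hu : Measurable u)
    (hu2 : ∫⁻ y, u y * u y < ⊤) {b : ℝ} (hb : 0 ≤ b) :
    ∀ᵐ x : Space, ∫⁻ y, riesz 2 (x - y) * (weight b y * u y) < ⊤ := by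
  obtain ⟨M, hM⟩ := exists_lintegral_riesz_two_mul_weight_le (b := 4) (s := 2) (by norm_num)
    (by norm_num) (by norm_num)
  have hlt : ∫⁻ x, weight 4 x * ∫⁻ y, riesz 2 (x - y) * (weight b y * u y) < ⊤ := by
    calc ∫⁻ x, weight 4 x * ∫⁻ y, riesz 2 (x - y) * (weight b y * u y)
        = ∫⁻ x, ∫⁻ y, weight 4 x * (riesz 2 (x - y) * (weight b y * u y)) := by
          refine lintegral_congr fun x => ?_
          rw [lintegral_const_mul _ (by fun_prop)]
      _ = ∫⁻ y, ∫⁻ x, weight 4 x * (riesz 2 (x - y) * (weight b y * u y)) :=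
          lintegral_lintegral_swap (by fun_prop)
      _ = ∫⁻ y, (∫⁻ x, riesz 2 (y - x) * weight 4 x) * (weight b y * u y) := by
          refine lintegral_congr fun y => ?_
          rw [← lintegral_mul_const _ (by fun_prop)]
          refine lintegral_congr fun x => ?_
          rw [riesz_sub_comm]; ring
      _ ≤ ∫⁻ y, M * (weight (2 + b) y * u y) := by
          refine lintegral_mono fun y => ?_
          calc _ ≤ M * weight 2 y * (weight b y * u y) := by gcongr; exact hM y
            _ = _ := by rw [← weight_mul_weight]; ring
      _ < ⊤ := by
          rw [lintegral_const_mul _ (by fun_prop)]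
          exact ENNReal.mul_lt_top (by simp)
            (lintegral_weight_mul_lt_top hu2 (by linarith))
  have hmeas : Measurable fun x : Space => ∫⁻ y, riesz 2 (x - y) * (weight b y * u y) :=
    Measurable.lintegral_prod_right' (f := fun p : Space × Space =>
      riesz 2 (p.1 - p.2) * (weight b p.2 * u p.2)) (by fun_prop)
  filter_upwards [ae_lt_top (by fun_prop) hlt.ne] with x hx
  exact (ENNReal.mul_lt_top_iff.1 hx).elim (fun h => h.2) fun h =>
    h.elim (fun h => absurd h (weight_ne_zero _ _)) fun h => by simp [h]

/-- A square-integrable subsolution of the weighted Riesz integral equation is bounded. -/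
lemma exists_ae_le_of_le_lintegral_riesz_two {u : Space → ℝ≥0∞} (hu : Measurable u)
    (hu2 : ∫⁻ y, u y * u y < ⊤) {b : ℝ} (hb : 1 < b) (c : ℝ≥0)
    (h : ∀ᵐ x : Space, u x ≤ c * ∫⁻ y, riesz 2 (x - y) * (weight b y * u y)) :
    ∃ M : ℝ≥0, ∀ᵐ x : Space, u x ≤ M * weight 0 x := by
  -- The exponent `s = 5/4` of the iterated kernel must satisfy `4 - s < 3` for the inner integral
  -- and `2s < 3` for its square to be locally integrable; any `1 < s < 3/2` would serve.
  obtain ⟨M₁, h₁⟩ := exists_lintegral_riesz_mul_weight_le (a := 4 - 5 / 4) (b := b) (by norm_num)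
    (by norm_num) (by linarith) (by linarith)
  obtain ⟨M₂, h₂⟩ := exists_lintegral_riesz_mul_weight_le (a := 2 * (5 / 4)) (b := b + b)
    (by norm_num) (by norm_num) (by linarith) (by linarith)
  set k : ℝ≥0 := (2 ^ (5 / 4 : ℝ) : ℝ).toNNReal
  set V : ℝ≥0 := (∫⁻ y, u y * u y).toNNReal
  have hV' : ∫⁻ y, u y * u y = V := (ENNReal.coe_toNNReal hu2.ne).symm
  have hkernel : ∀ x y : Space, x ≠ y →
      ∫⁻ z, riesz 2 (x - z) * riesz 2 (z - y) * weight b z ≤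
        k * riesz (5 / 4) (x - y) * (M₁ + M₁) := by
    intro x y hxy
    calc _ ≤ ∫⁻ z, k * riesz (5 / 4) (x - y) *
          (riesz (4 - 5 / 4) (x - z) * weight b z + riesz (4 - 5 / 4) (y - z) * weight b z) := by
          refine lintegral_mono fun z => ?_
          rw [← add_mul, ← mul_assoc]
          gcongr ?_ * _
          exact riesz_two_mul_riesz_two_le (s := 5 / 4) (by norm_num) (by norm_num) hxy z
      _ ≤ _ := by
          rw [lintegral_const_mul _ (by fun_prop), lintegral_add_left (by fun_prop)]
          gcongr
          · exact h₁ x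
          · exact h₁ y
  refine ⟨c * (c * (k * (M₁ + M₁) * (M₂ + V))), ?_⟩
  filter_upwards [h] with x hx
  rw [weight_zero, mul_one]
  refine hx.trans ?_
  push_cast
  gcongr
  -- The inequality is inserted into itself and the integrals swapped, so that the iterated kernel
  -- acts on `u`.
  calc ∫⁻ y, riesz 2 (x - y) * (weight b y * u y)
      ≤ ∫⁻ z, riesz 2 (x - z) * (weight b z *
          (c * ∫⁻ y, riesz 2 (z - y) * (weight b y * u y))) := by
        refine lintegral_mono_ae (h.mono fun z hz => ?_)
        gcongr
    _ = ∫⁻ z, ∫⁻ y, c * ((riesz 2 (x - z) * riesz 2 (z - y) * weight b z) *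
          (weight b y * u y)) := by
        refine lintegral_congr fun z => ?_
        rw [← mul_assoc, ← mul_assoc, ← lintegral_const_mul _ (by fun_prop)]
        refine lintegral_congr fun y => ?_
        ring
    _ = ∫⁻ y, c * ((∫⁻ z, riesz 2 (x - z) * riesz 2 (z - y) * weight b z) *
          (weight b y * u y)) := by
        rw [lintegral_lintegral_swap (by fun_prop)]
        refine lintegral_congr fun y => ?_
        rw [lintegral_const_mul _ (by fun_prop), lintegral_mul_const _ (by fun_prop)]
    _ ≤ ∫⁻ y, c * (k * (M₁ + M₁) *
          (riesz (2 * (5 / 4)) (x - y) * weight (b + b) y + u y * u y)) := by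
        refine lintegral_mono_ae ((ae_ne_space x).mono fun y hy => ?_)
        -- Cauchy–Schwarz in the form `pq ≤ p² + q²`.
        have h3 : riesz (5 / 4) (x - y) * weight b y * u y ≤
            riesz (2 * (5 / 4)) (x - y) * weight (b + b) y + u y * u y := by
          rw [← riesz_mul_self, ← weight_mul_weight]
          rcases le_total (riesz (5 / 4) (x - y) * weight b y) (u y) with h | h
          · exact le_add_left (by gcongr)
          · refine le_add_right ((mul_le_mul_right h _).trans_eq ?_)
            ring
        calc _ ≤ c * (k * riesz (5 / 4) (x - y) * (M₁ + M₁) * (weight b y * u y)) := by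
              gcongr; exact hkernel x y hy
          _ = c * (k * (M₁ + M₁) * (riesz (5 / 4) (x - y) * weight b y * u y)) := by ring
          _ ≤ _ := by gcongr
    _ ≤ _ := by
        rw [lintegral_const_mul _ (by fun_prop), lintegral_const_mul _ (by fun_prop),
          lintegral_add_left (by fun_prop), hV']
        gcongr
        exact h₂ x

/-- One step of the bootstrap for decay. -/
lemma exists_ae_le_weight_of_le_weight {u : Space → ℝ≥0∞} {b : ℝ} (c : ℝ≥0)
    (h : ∀ᵐ x : Space, u x ≤ c * ∫⁻ y, riesz 2 (x - y) * (weight b y * u y))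
    {a s : ℝ} (hs : 0 ≤ s) (hs2 : s ≤ 2) (hsa : s + 1 < a + b)
    (ha : ∃ M : ℝ≥0, ∀ᵐ x : Space, u x ≤ M * weight a x) :
    ∃ M : ℝ≥0, ∀ᵐ x : Space, u x ≤ M * weight s x := by
  obtain ⟨M, hM⟩ := ha
  obtain ⟨K, hK⟩ := exists_lintegral_riesz_two_mul_weight_le hs hs2 hsa
  refine ⟨c * (M * K), h.mono fun x hx => hx.trans ?_⟩
  push_cast
  rw [mul_assoc, mul_assoc]
  gcongr
  calc _ ≤ ∫⁻ y, M * (riesz 2 (x - y) * weight (a + b) y) := by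
        refine lintegral_mono_ae (hM.mono fun y hy => ?_)
        calc _ ≤ riesz 2 (x - y) * (weight b y * (M * weight a y)) := by gcongr
          _ = _ := by rw [← weight_mul_weight]; ring
    _ ≤ _ := by
        rw [lintegral_const_mul _ (by fun_prop)]
        gcongr
        exact hK x

/-- Quadratic decay of square-integrable subsolutions. -/
lemma exists_ae_le_weight_two {u : Space → ℝ≥0∞} (hu : Measurable u)
    (hu2 : ∫⁻ y, u y * u y < ⊤) {b : ℝ} (hb : 1 < b) (c : ℝ≥0)
    (h : ∀ᵐ x : Space, u x ≤ c * ∫⁻ y, riesz 2 (x - y) * (weight b y * u y)) :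
    ∃ M : ℝ≥0, ∀ᵐ x : Space, u x ≤ M * weight 2 x := by
  -- A pass can gain anything strictly less than `b - 1`; half of that is taken, and the exponent is
  -- capped at the kernel's own decay `2`.
  have hstep : ∀ n : ℕ, ∃ M : ℝ≥0, ∀ᵐ x : Space,
      u x ≤ M * weight (min 2 (n * ((b - 1) / 2))) x := by
    intro n
    induction n with
    | zero =>
      simpa using exists_ae_le_of_le_lintegral_riesz_two hu hu2 hb c h
    | succ n ih =>
      refine exists_ae_le_weight_of_le_weight c h ?_ (min_le_left _ _) ?_ ih
      · have : 0 < b - 1 := by linarith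
        positivity
      · push_cast
        rcases min_choice 2 (n * ((b - 1) / 2)) with h' | h' <;> rw [h']
        · linarith [min_le_left 2 ((n + 1 : ℝ) * ((b - 1) / 2))]
        · linarith [min_le_right 2 ((n + 1 : ℝ) * ((b - 1) / 2))]
  obtain ⟨n, hn⟩ := exists_nat_ge (2 / ((b - 1) / 2))
  rw [div_le_iff₀ (by linarith)] at hn
  simpa [min_eq_left hn] using hstep n

/-! ### Pauli algebra. -/

/-- The Pauli matrix `σⱼ` as a continuous linear map on spinors. -/
def sigma (j : Fin 3) : Spinor →L[ℂ] Spinor := Matrix.toEuclideanCLM (𝕜 := ℂ) (pauli j)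

lemma act_pauli (j : Fin 3) (w : Spinor) : act (pauli j) w = sigma j w := rfl

/-- The pairing `(v, w) ↦ (σ · v) w`. -/
def sigmaDot : Space →L[ℝ] Spinor →L[ℝ] Spinor :=
  ∑ j, (EuclideanSpace.proj j : Space →L[ℝ] ℝ).smulRight ((sigma j).restrictScalars ℝ)

lemma sigmaDot_apply (v : Space) (w : Spinor) :
    sigmaDot v w = ∑ j, ((v j : ℝ) : ℂ) • sigma j w := by
  simp [sigmaDot]

lemma sigma_zero_apply (w : Spinor) : sigma 0 w = !₂[w 1, w 0] := by
  rw [← act_pauli]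
  ext i
  fin_cases i <;> simp [act, pauli, dotProduct, Fin.sum_univ_two]

lemma sigma_one_apply (w : Spinor) :
    sigma 1 w = !₂[-(Complex.I * w 1), Complex.I * w 0] := by
  rw [← act_pauli]
  ext i
  fin_cases i <;> simp [act, pauli, dotProduct, Fin.sum_univ_two]

lemma sigma_two_apply (w : Spinor) : sigma 2 w = !₂[w 0, -w 1] := by
  rw [← act_pauli]
  ext i
  fin_cases i <;> simp [act, pauli, dotProduct, Fin.sum_univ_two]

/-- `σ·v` is Hermitian with square `|v|²`, hence `|v|` times a unitary when `v ≠ 0`. -/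
lemma norm_sigmaDot (v : Space) (w : Spinor) : ‖sigmaDot v w‖ = ‖v‖ * ‖w‖ := by
  rw [← sq_eq_sq₀ (norm_nonneg _) (by positivity), mul_pow, EuclideanSpace.norm_sq_eq,
    EuclideanSpace.norm_sq_eq, EuclideanSpace.norm_sq_eq]
  simp only [sigmaDot_apply, Fin.sum_univ_three, Fin.sum_univ_two, sigma_zero_apply,
    sigma_one_apply, sigma_two_apply, Complex.sq_norm, Complex.normSq_apply]
  simp
  ring

lemma enorm_sigmaDot (v : Space) (w : Spinor) : ‖sigmaDot v w‖ₑ = ‖v‖ₑ * ‖w‖ₑ := by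
  rw [← ofReal_norm, norm_sigmaDot, ENNReal.ofReal_mul (norm_nonneg _), ofReal_norm, ofReal_norm]

/-- Only the trace of a symmetric matrix survives contraction with `σₖ σⱼ`. -/
lemma sum_sigma_sigma_of_symm (a : Fin 3 → Fin 3 → ℂ) (ha : ∀ j k, a j k = a k j) (w : Spinor) :
    ∑ k, ∑ j, a j k • sigma k (sigma j w) = (∑ j, a j j) • w := by
  have hI := Complex.I_mul_I
  ext i
  simp only [Fin.sum_univ_three, sigma_zero_apply, sigma_one_apply, sigma_two_apply,
    ha 1 0, ha 2 0, ha 2 1]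
  fin_cases i
  · simp
    linear_combination (-(a 1 1) * w 0) * hI
  · simp
    linear_combination (-(a 1 1) * w 1) * hI

/-- This is `σⱼσₖ = δⱼₖ + i εⱼₖₗ σₗ`; it identifies the matrix of the theorem with the product that
the Green kernel produces. -/
lemma act_limitMatrix (ω a : Space) (w : Spinor) :
    act (limitMatrix ω a) w = sigmaDot ω (sigmaDot a w) := by
  have hI := Complex.I_mul_I
  rw [sigmaDot_apply, sigmaDot_apply]
  ext i
  simp only [Fin.sum_univ_three, sigma_zero_apply, sigma_one_apply, sigma_two_apply]
  fin_cases i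
  · simp [act, limitMatrix, pauliDot, pauli, Fin.sum_univ_three, crossProduct, PiLp.inner_apply]
    ring_nf
    simp
    ring
  · simp [act, limitMatrix, pauliDot, pauli, Fin.sum_univ_three, crossProduct, PiLp.inner_apply]
    ring_nf
    simp
    ring

/-! ### The weak equation tested against radial fields. -/

lemma integral_smul_eq_of_lineDeriv {ψ P : Lp Spinor 2 (volume : Measure Space)} {v : Space}
    (h : (-Complex.I) • ∂_{v} (ψ : 𝓢'(Space, Spinor)) = (P : 𝓢'(Space, Spinor)))
    {g : Space → ℝ} (hg : ContDiff ℝ (⊤ : ℕ∞) g) (hgc : HasCompactSupport g) :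
    ∫ y, g y • P y = Complex.I • ∫ y, fderiv ℝ g y v • ψ y := by
  have hG : ContDiff ℝ (⊤ : ℕ∞) (fun y => (g y : ℂ)) := Complex.ofRealCLM.contDiff.comp hg
  have hGc : HasCompactSupport (fun y => (g y : ℂ)) := hgc.comp_left (g := ((↑) : ℝ → ℂ)) rfl
  have h2 := congrArg (fun T : 𝓢'(Space, Spinor) => T (hGc.toSchwartzMap hG)) h
  simp only [Lp.toTemperedDistribution_apply] at h2
  have h3 : ((-Complex.I) • ∂_{v} (ψ : 𝓢'(Space, Spinor))) (hGc.toSchwartzMap hG) =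
      (-Complex.I) • (∂_{v} (ψ : 𝓢'(Space, Spinor))) (hGc.toSchwartzMap hG) := rfl
  rw [h3, TemperedDistribution.lineDerivOp_apply_apply, Lp.toTemperedDistribution_apply] at h2
  have h4 : ∀ y, (∂_{v} (hGc.toSchwartzMap hG) : 𝓢(Space, ℂ)) y = ((fderiv ℝ g y v : ℝ) : ℂ) := by
    intro y
    rw [SchwartzMap.lineDerivOp_apply_eq_fderiv]
    have h5 : HasFDerivAt (fun y => (g y : ℂ)) (Complex.ofRealCLM.comp (fderiv ℝ g y)) y :=
      Complex.ofRealCLM.hasFDerivAt.comp y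
        ((hg.differentiable (by simp)) y).hasFDerivAt
    have h6 : (⇑(hGc.toSchwartzMap hG) : Space → ℂ) = fun y => (g y : ℂ) := rfl
    rw [h6, h5.fderiv]
    rfl
  simp [h4, integral_neg] at h2
  exact h2.symm

/-- The point is the symmetry in `j` and `k`, together with the trace; the minus sign comes from
differentiating in `y`. -/
lemma fderiv_coord_mul_radial {κ : ℝ → ℝ} (hκ : Differentiable ℝ κ) (x y : Space)
    (j k : Fin 3) :
    fderiv ℝ (fun y : Space => (x - y) k * κ (‖x - y‖ ^ 2)) y (unitVec j) =
      -((if j = k then κ (‖x - y‖ ^ 2) else 0) +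
        2 * (x - y) j * (x - y) k * deriv κ (‖x - y‖ ^ 2)) := by
  have h1 : HasFDerivAt (fun y : Space => x - y) (-(ContinuousLinearMap.id ℝ Space)) y := by
    simpa using (hasFDerivAt_id y).const_sub x
  have h2 : HasFDerivAt (fun y : Space => (x - y) k)
      ((EuclideanSpace.proj k : Space →L[ℝ] ℝ).comp (-(ContinuousLinearMap.id ℝ Space))) y :=
    (EuclideanSpace.proj k : Space →L[ℝ] ℝ).hasFDerivAt.comp y h1
  have h3 := h1.norm_sq
  have h4 := (hκ (‖x - y‖ ^ 2)).hasDerivAt.comp_hasFDerivAt y h3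
  have h5 := h2.mul h4
  have h6 : (fun y : Space => (x - y) k * κ (‖x - y‖ ^ 2)) =
    (fun y : Space => (x - y) k) * (κ ∘ fun y : Space => ‖x - y‖ ^ 2) := rfl
  rw [h6, h5.fderiv]
  have h7 : (unitVec j).ofLp k = if j = k then 1 else 0 := by
    simp [unitVec, eq_comm]
  have h8 : ∀ w : Space, inner ℝ w (unitVec j) = w j := fun w => by
    simp [unitVec, EuclideanSpace.inner_single_right]
  simp [h7, h8]
  ring

lemma hasCompactSupport_comp_norm_sq {κ : ℝ → ℝ} {R : ℝ} (hR : ∀ t, R ≤ t → κ t = 0) (x : Space) :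
    HasCompactSupport (fun y : Space => κ (‖x - y‖ ^ 2)) := by
  refine HasCompactSupport.of_support_subset_isCompact
    (isCompact_closedBall x (max R 1)) fun y hy => ?_
  by_contra h
  refine hy (hR _ ?_)
  rw [Metric.mem_closedBall, dist_eq_norm, norm_sub_rev, not_le] at h
  have h1 := le_max_left R 1
  have h2 := le_max_right R 1
  nlinarith

/-- The Weyl–Dirac equation tested against `σ · (x - y) κ(|x - y|²)`. -/
lemma integral_radial_smul_sigmaDot {A : Space → Space} {ψ : Lp Spinor 2 (volume : Measure Space)}
    (hψ : IsZeroMode A ψ) {κ : ℝ → ℝ} (hκ : ContDiff ℝ (⊤ : ℕ∞) κ) {R : ℝ}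
    (hR : ∀ t, R ≤ t → κ t = 0) (x : Space) :
    Complex.I • ∫ y, κ (‖x - y‖ ^ 2) • sigmaDot (x - y) (sigmaDot (A y) (ψ y)) =
      ∫ y, (3 * κ (‖x - y‖ ^ 2) + 2 * ‖x - y‖ ^ 2 * deriv κ (‖x - y‖ ^ 2)) • ψ y := by
  obtain ⟨-, P, hP, hAP⟩ := hψ
  set g : Fin 3 → Space → ℝ := fun k y => (x - y) k * κ (‖x - y‖ ^ 2) with hg_def
  have hg : ∀ k, ContDiff ℝ (⊤ : ℕ∞) (g k) := by
    intro k
    have : ContDiff ℝ (⊤ : ℕ∞) fun y : Space => (x - y) k :=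
      (EuclideanSpace.proj k : Space →L[ℝ] ℝ).contDiff.comp (contDiff_const.sub contDiff_id)
    exact this.mul (hκ.comp ((contDiff_const.sub contDiff_id).norm_sq ℝ))
  have hgc : ∀ k, HasCompactSupport (g k) := fun k =>
    (hasCompactSupport_comp_norm_sq hR x).mul_left
  have hloc : ∀ Q : Lp Spinor 2 (volume : Measure Space), LocallyIntegrable Q volume := fun Q =>
    (Lp.memLp Q).locallyIntegrable (by norm_num)
  have hgP : ∀ k j, Integrable (fun y => g k y • P j y) := fun k j =>
    (hloc (P j)).integrable_smul_left_of_hasCompactSupport (hg k).continuous (hgc k)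
  set a : Fin 3 → Fin 3 → Space → ℝ := fun j k y => fderiv ℝ (g k) y (unitVec j)
  have ha : ∀ j k y, a j k y = -((if j = k then κ (‖x - y‖ ^ 2) else 0) +
        2 * (x - y) j * (x - y) k * deriv κ (‖x - y‖ ^ 2)) := fun j k y =>
    fderiv_coord_mul_radial (hκ.differentiable (by simp)) x y j k
  have haψ : ∀ j k, Integrable (fun y => a j k y • ψ y) := fun j k =>
    (hloc ψ).integrable_smul_left_of_hasCompactSupport
      (((hg k).continuous_fderiv (by simp)).clm_apply continuous_const)
      ((hgc k).fderiv_apply (𝕜 := ℝ) (unitVec j))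
  have hf : ∀ᵐ y, sigmaDot (A y) (ψ y) = ∑ j, sigma j (P j y) := by
    filter_upwards [hAP] with y hy
    simp only [act_pauli, map_sub, map_smul, Finset.sum_sub_distrib] at hy
    rw [sigmaDot_apply, ← sub_eq_zero.1 hy]
  have h1 : ∫ y, κ (‖x - y‖ ^ 2) • sigmaDot (x - y) (sigmaDot (A y) (ψ y)) =
      ∫ y, ∑ k, ∑ j, sigma k (sigma j (g k y • P j y)) := by
    refine integral_congr_ae (hf.mono fun y hy => ?_)
    simp only []
    rw [hy, sigmaDot_apply, Finset.smul_sum]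
    refine Finset.sum_congr rfl fun k _ => ?_
    rw [map_sum, Finset.smul_sum, Finset.smul_sum]
    refine Finset.sum_congr rfl fun j _ => ?_
    rw [hg_def, ← Complex.coe_smul, ← Complex.coe_smul, smul_smul, map_smul, map_smul]
    push_cast
    rw [mul_comm]
  have h2 : ∀ k j, ∫ y, sigma k (sigma j (g k y • P j y)) =
      Complex.I • ∫ y, ((a j k y : ℝ) : ℂ) • sigma k (sigma j (ψ y)) := by
    intro k j
    have h3 := integral_smul_eq_of_lineDeriv (hP j) (hg k) (hgc k)
    have h4 := ((sigma k).comp (sigma j)).integral_comp_comm (hgP k j)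
    have h5 := ((sigma k).comp (sigma j)).integral_comp_comm (haψ j k)
    simp only [ContinuousLinearMap.comp_apply] at h4 h5
    rw [h4, h3, map_smul, map_smul, ← h5]
    congr 2
    ext1 y
    rw [← Complex.coe_smul, map_smul, map_smul]
  have haσ : ∀ j k, Integrable (fun y => ((a j k y : ℝ) : ℂ) • sigma k (sigma j (ψ y))) := by
    intro j k
    refine (((sigma k).comp (sigma j)).integrable_comp (haψ j k)).congr (.of_forall fun y => ?_)
    simp only [ContinuousLinearMap.comp_apply]
    rw [← Complex.coe_smul, map_smul, map_smul]
  have hgσ : ∀ k j, Integrable (fun y => sigma k (sigma j (g k y • P j y))) := fun k j =>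
    ((sigma k).comp (sigma j)).integrable_comp (hgP k j)
  rw [h1, integral_finsetSum _ fun k _ => integrable_finsetSum _ fun j _ => hgσ k j]
  simp_rw [integral_finsetSum _ fun j _ => hgσ _ j, h2, ← Finset.smul_sum]
  -- `i · i = -1` will cancel the minus sign of the derivatives in `y`.
  rw [smul_smul, Complex.I_mul_I, neg_one_smul]
  simp_rw [← integral_finsetSum _ fun j _ => haσ j _]
  rw [← integral_finsetSum _ fun k _ => integrable_finsetSum _ fun j _ => haσ j k,
    ← integral_neg]
  refine integral_congr_ae (.of_forall fun y => ?_)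
  simp only []
  -- Only the trace, minus the divergence of `z κ(|z|²)`, remains.
  rw [sum_sigma_sigma_of_symm (fun j k => ((a j k y : ℝ) : ℂ)), ← neg_smul]
  · rw [← Complex.coe_smul]
    congr 1
    rw [← Complex.ofReal_sum, ← Complex.ofReal_neg]
    congr 1
    simp only [ha, Fin.sum_univ_three, if_true]
    rw [EuclideanSpace.real_norm_sq_eq, Fin.sum_univ_three]
    ring
  · intro j k
    simp only [ha, eq_comm (a := j)]
    split_ifs with h
    · subst h; rfl
    · push_cast; ring

/-! ### Annular truncations and mollifiers. -/

/-- A smooth monotone function equal to `0` on `(-∞, 1]` and to `1` on `[2, ∞)`. -/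
def cutoff (t : ℝ) : ℝ := Real.smoothTransition (t - 1)

lemma contDiff_cutoff : ContDiff ℝ (⊤ : ℕ∞) cutoff :=
  Real.smoothTransition.contDiff.comp (contDiff_id.sub contDiff_const)

lemma differentiable_cutoff : Differentiable ℝ cutoff :=
  contDiff_cutoff.differentiable (by simp)

lemma continuous_deriv_cutoff : Continuous (deriv cutoff) :=
  contDiff_cutoff.continuous_deriv (by simp)

lemma monotone_cutoff : Monotone cutoff := fun a b h =>
  Real.smoothTransition.monotone (by linarith)

lemma cutoff_nonneg (t : ℝ) : 0 ≤ cutoff t := Real.smoothTransition.nonneg _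

lemma cutoff_le_one (t : ℝ) : cutoff t ≤ 1 := Real.smoothTransition.le_one _

lemma cutoff_of_le_one {t : ℝ} (h : t ≤ 1) : cutoff t = 0 :=
  Real.smoothTransition.zero_of_nonpos (by linarith)

lemma cutoff_of_two_le {t : ℝ} (h : 2 ≤ t) : cutoff t = 1 :=
  Real.smoothTransition.one_of_one_le (by linarith)

lemma deriv_cutoff_of_lt_one {t : ℝ} (h : t < 1) : deriv cutoff t = 0 := by
  have : cutoff =ᶠ[𝓝 t] fun _ => 0 := by
    filter_upwards [Iio_mem_nhds h] with s hs using cutoff_of_le_one (le_of_lt hs)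
  rw [this.deriv_eq, deriv_const]

lemma deriv_cutoff_of_two_lt {t : ℝ} (h : 2 < t) : deriv cutoff t = 0 := by
  have : cutoff =ᶠ[𝓝 t] fun _ => 1 := by
    filter_upwards [Ioi_mem_nhds h] with s hs using cutoff_of_two_le (le_of_lt hs)
  rw [this.deriv_eq, deriv_const]

lemma exists_abs_deriv_cutoff_le : ∃ B : ℝ, 0 ≤ B ∧ ∀ t, |deriv cutoff t| ≤ B := by
  have hc : HasCompactSupport (deriv cutoff) := by
    refine HasCompactSupport.of_support_subset_isCompact (isCompact_Icc (a := 1) (b := 2)) ?_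
    intro t ht
    by_contra h
    rw [Set.mem_Icc, not_and_or, not_le, not_le] at h
    exact ht (h.elim deriv_cutoff_of_lt_one deriv_cutoff_of_two_lt)
  obtain ⟨B, hB⟩ := continuous_deriv_cutoff.bounded_above_of_compact_support hc
  exact ⟨B, (norm_nonneg _).trans (hB 0), hB⟩

/-- A smooth truncation of `t ^ (-3/2)` to the annulus `L⁻¹ ≤ t ≤ 2L`. -/
def annular (L t : ℝ) : ℝ := (cutoff (L * t) - cutoff (L⁻¹ * t)) * (√t ^ 3)⁻¹

lemma annular_of_small {L t : ℝ} (hL : 1 ≤ L) (h : L * t ≤ 1) : annular L t = 0 := by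
  have h2 : L⁻¹ * t ≤ 1 := by
    rcases le_total t 0 with h0 | h0
    · have : L⁻¹ * t ≤ 0 := mul_nonpos_of_nonneg_of_nonpos (by positivity) h0
      linarith
    · have : L⁻¹ ≤ L := (inv_le_one_of_one_le₀ hL).trans hL
      exact (mul_le_mul_of_nonneg_right this h0).trans h
  rw [annular, cutoff_of_le_one h, cutoff_of_le_one h2]
  simp

lemma annular_of_large {L t : ℝ} (hL : 1 ≤ L) (h : 2 * L ≤ t) : annular L t = 0 := by
  have hL0 : 0 < L := by linarith
  have h2 : 2 ≤ L⁻¹ * t := by rwa [inv_mul_eq_div, le_div_iff₀ hL0]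
  rw [annular, cutoff_of_two_le h2, cutoff_of_two_le (by nlinarith)]
  simp

/-- The cutoffs vanish on a neighbourhood of `t ≤ 0`, which hides the singularity of the square
root. -/
lemma contDiff_annular {L : ℝ} (hL : 1 ≤ L) : ContDiff ℝ (⊤ : ℕ∞) (annular L) := by
  have hL0 : 0 < L := by linarith
  rw [contDiff_iff_contDiffAt]
  intro t
  rcases le_or_gt t 0 with ht | ht
  · have h : annular L =ᶠ[𝓝 t] fun _ => 0 := by
      filter_upwards [Iio_mem_nhds (show t < L⁻¹ from ht.trans_lt (by positivity))] with s hs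
      refine annular_of_small hL ?_
      rw [mul_comm, ← le_div_iff₀ hL0, one_div]
      exact le_of_lt hs
    exact contDiffAt_const.congr_of_eventuallyEq h
  · refine ContDiffAt.mul ?_ (((Real.contDiffAt_sqrt ht.ne').pow 3).inv (by positivity))
    exact ((contDiff_cutoff.comp (contDiff_const.mul contDiff_id)).sub
      (contDiff_cutoff.comp (contDiff_const.mul contDiff_id))).contDiffAt

lemma abs_annular_le (L t : ℝ) : |annular L t| ≤ (√t ^ 3)⁻¹ := by
  rw [annular, abs_mul, abs_of_nonneg (show 0 ≤ (√t ^ 3)⁻¹ by positivity)]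
  refine mul_le_of_le_one_left (by positivity) (abs_sub_le_iff.2 ⟨?_, ?_⟩)
  · linarith [cutoff_le_one (L * t), cutoff_nonneg (L⁻¹ * t)]
  · linarith [cutoff_nonneg (L * t), cutoff_le_one (L⁻¹ * t)]

lemma tendsto_annular {t : ℝ} (ht : 0 < t) :
    Tendsto (fun L => annular L t) atTop (𝓝 (√t ^ 3)⁻¹) := by
  refine tendsto_const_nhds.congr' ?_
  filter_upwards [eventually_ge_atTop (2 / t), eventually_ge_atTop t, eventually_gt_atTop 0]
    with L h1 h2 h3
  rw [annular, cutoff_of_two_le ((div_le_iff₀ ht).1 h1), cutoff_of_le_one]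
  · simp
  · rwa [inv_mul_eq_div, div_le_one h3]

/-- The radial mollifier at scale `L^(-1/2)` which is the divergence of
`cutoff (L |z|²) z / (4π|z|³)`. -/
def mollifier (L : ℝ) (z : Space) : ℝ :=
  (4 * Real.pi)⁻¹ * (2 * L * deriv cutoff (L * ‖z‖ ^ 2) / ‖z‖)

lemma continuous_mollifier (L : ℝ) : Continuous (mollifier L) := by
  rw [continuous_iff_continuousAt]
  intro z
  rcases eq_or_ne z 0 with rfl | hz
  · have h : mollifier L =ᶠ[𝓝 0] fun _ => 0 := by
      have h2 : ∀ᶠ z : Space in 𝓝 0, L * ‖z‖ ^ 2 < 1 := by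
        have : ContinuousAt (fun z : Space => L * ‖z‖ ^ 2) 0 := by fun_prop
        exact this.eventually_lt continuousAt_const (by simp)
      filter_upwards [h2] with z hz
      simp [mollifier, deriv_cutoff_of_lt_one hz]
    exact continuousAt_const.congr h.symm
  · have := continuous_deriv_cutoff
    have hz' : ‖z‖ ≠ 0 := norm_ne_zero_iff.2 hz
    unfold mollifier
    fun_prop (disch := assumption)

/-- `z/|z|³` is divergence-free off the origin, so only the derivatives of the two cutoffs
contribute. -/
lemma divergence_annular {L : ℝ} (hL : 1 ≤ L) (z : Space) :
    3 * annular L (‖z‖ ^ 2) + 2 * ‖z‖ ^ 2 * deriv (annular L) (‖z‖ ^ 2) =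
      4 * Real.pi * (mollifier L z - mollifier L⁻¹ z) := by
  rcases eq_or_ne z 0 with rfl | hz
  · simp [annular, mollifier, deriv_cutoff_of_lt_one, cutoff_of_le_one]
  have hz' : 0 < ‖z‖ := norm_pos_iff.2 hz
  have hsq : √(‖z‖ ^ 2) = ‖z‖ := Real.sqrt_sq hz'.le
  have h1 : ∀ c : ℝ, HasDerivAt (fun t => cutoff (c * t)) (deriv cutoff (c * ‖z‖ ^ 2) * c)
      (‖z‖ ^ 2) := by
    intro c
    have := (differentiable_cutoff (c * ‖z‖ ^ 2)).hasDerivAt.comp (‖z‖ ^ 2)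
      ((hasDerivAt_id (‖z‖ ^ 2)).const_mul c)
    simpa [Function.comp_def] using this
  have h2 := ((Real.hasDerivAt_sqrt (show ‖z‖ ^ 2 ≠ 0 by positivity)).pow 3).inv
    (by rw [Pi.pow_apply, hsq]; positivity)
  have h3 := (((h1 L).sub (h1 L⁻¹)).mul h2).deriv
  have h4 : annular L = ((fun t => cutoff (L * t)) - fun t => cutoff (L⁻¹ * t)) *
    (Real.sqrt ^ 3)⁻¹ := rfl
  rw [← h4] at h3
  rw [h3]
  simp only [annular, mollifier, hsq, Pi.sub_apply, Pi.pow_apply, Pi.inv_apply]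
  have := Real.pi_pos
  field_simp
  ring

/-- In polar coordinates the integrand is the derivative of `cutoff (L t²)`, which climbs from `0`
to `1`; the sphere's area cancels `4π`. -/
lemma integral_mollifier {L : ℝ} (hL : 0 < L) : ∫ z, mollifier L z = 1 := by
  have h1 : ∫ t in Set.Ioi (0 : ℝ), deriv cutoff (L * t ^ 2) * (L * (2 * t)) = 1 := by
    have hd : ∀ t : ℝ, HasDerivAt (fun t => cutoff (L * t ^ 2))
        (deriv cutoff (L * t ^ 2) * (L * (2 * t))) t := by
      intro t
      have := (differentiable_cutoff (L * t ^ 2)).hasDerivAt.comp t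
        ((hasDerivAt_pow 2 t).const_mul L)
      simpa [Function.comp_def] using this
    have hlim : Tendsto (fun t => cutoff (L * t ^ 2)) atTop (𝓝 1) := by
      refine tendsto_const_nhds.congr' ?_
      filter_upwards [((tendsto_pow_atTop two_ne_zero).const_mul_atTop hL).eventually_ge_atTop 2]
        with t ht using (cutoff_of_two_le ht).symm
    rw [integral_Ioi_of_hasDerivAt_of_nonneg' (fun t _ => hd t) (fun t ht => ?_) hlim]
    · simp [cutoff_of_le_one]
    · have := monotone_cutoff.deriv_nonneg (x := L * t ^ 2)
      have ht' : (0 : ℝ) < t := ht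
      positivity
  have h2 := integral_fun_norm_addHaar (volume : Measure Space)
    (fun t => (4 * Real.pi)⁻¹ * (2 * L * deriv cutoff (L * t ^ 2) / t))
  have h3 : ∫ t in Set.Ioi (0 : ℝ), t ^ (Module.finrank ℝ Space - 1) •
      ((4 * Real.pi)⁻¹ * (2 * L * deriv cutoff (L * t ^ 2) / t)) = (4 * Real.pi)⁻¹ := by
    calc _ = ∫ t in Set.Ioi (0 : ℝ),
          (4 * Real.pi)⁻¹ * (deriv cutoff (L * t ^ 2) * (L * (2 * t))) := by
          refine setIntegral_congr_fun measurableSet_Ioi fun t ht => ?_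
          have ht' : (0 : ℝ) < t := ht
          simp only [finrank_euclideanSpace, Fintype.card_fin, smul_eq_mul]
          norm_num
          field_simp
      _ = _ := by rw [integral_const_mul, h1, mul_one]
  rw [h3] at h2
  change ∫ z : Space, (4 * Real.pi)⁻¹ * (2 * L * deriv cutoff (L * ‖z‖ ^ 2) / ‖z‖) = 1
  rw [h2]
  have := Real.pi_pos
  simp only [finrank_euclideanSpace, Fintype.card_fin, measureReal_def,
    EuclideanSpace.volume_ball_fin_three, ENNReal.ofReal_one, one_pow, one_mul]
  rw [ENNReal.toReal_ofReal (by positivity), smul_eq_mul, nsmul_eq_mul]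
  field_simp
  norm_num

/-- With `L = 2/r²` the mollifier lives where `|z|` is between `r/√2` and `r`, so its size is that
of an average over the ball of radius `r`. -/
lemma exists_abs_mollifier_le : ∃ B : ℝ, 0 ≤ B ∧ ∀ r : ℝ, 0 < r → ∀ z,
    |mollifier (2 / r ^ 2) z| ≤ B / r ^ 3 := by
  obtain ⟨B, hB, h⟩ := exists_abs_deriv_cutoff_le
  refine ⟨(4 * Real.pi)⁻¹ * (8 * B), by positivity, fun r hr z => ?_⟩
  by_cases hz : 2 / r ^ 2 * ‖z‖ ^ 2 < 1
  · rw [mollifier, deriv_cutoff_of_lt_one hz]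
    simp; positivity
  have hz2 : r / 2 ≤ ‖z‖ := by
    rw [div_mul_eq_mul_div, div_lt_one (by positivity), not_lt] at hz
    nlinarith [norm_nonneg z]
  have hz0 : 0 < ‖z‖ := by linarith [half_pos hr]
  rw [mollifier, abs_mul, abs_of_nonneg (show 0 ≤ (4 * Real.pi)⁻¹ by positivity), abs_div, abs_mul,
    abs_of_nonneg (show 0 ≤ 2 * (2 / r ^ 2) by positivity), abs_of_pos hz0, mul_div_assoc (4 * Real.pi)⁻¹]
  refine mul_le_mul_of_nonneg_left ?_ (by positivity)
  calc 2 * (2 / r ^ 2) * |deriv cutoff (2 / r ^ 2 * ‖z‖ ^ 2)| / ‖z‖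
      ≤ 2 * (2 / r ^ 2) * B / (r / 2) := by gcongr; exact h _
    _ = 8 * B / r ^ 3 := by field_simp; ring

lemma mollifier_of_lt_norm {r : ℝ} (hr : 0 < r) {z : Space} (hz : r < ‖z‖) :
    mollifier (2 / r ^ 2) z = 0 := by
  rw [mollifier, deriv_cutoff_of_two_lt]
  · simp
  · rw [div_mul_eq_mul_div, lt_div_iff₀ (by positivity)]
    nlinarith

/-! ### The Coulomb representation of a zero mode. -/

/-- The field `z / |z|³`. -/
def coulomb (z : Space) : Space := (‖z‖ ^ 3)⁻¹ • z

lemma norm_coulomb (z : Space) : ‖coulomb z‖ = ‖z‖ ^ (-2 : ℝ) := by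
  rw [coulomb, norm_smul, norm_inv, norm_pow, norm_norm]
  rcases (norm_nonneg z).eq_or_lt with h | h
  · rw [← h, Real.zero_rpow (by norm_num)]; simp
  · rw [Real.rpow_neg h.le]
    norm_cast
    field_simp

lemma enorm_coulomb (z : Space) : ‖coulomb z‖ₑ = riesz 2 z := by
  rw [← ofReal_norm, norm_coulomb, riesz]

@[fun_prop]
lemma measurable_coulomb : Measurable coulomb := by
  unfold coulomb; fun_prop

lemma aestronglyMeasurable_sigmaDot {B : Space → Space} {f : Space → Spinor}
    (hB : AEMeasurable B) (hf : AEStronglyMeasurable f) :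
    AEStronglyMeasurable (fun y => sigmaDot (B y) (f y)) :=
  sigmaDot.aestronglyMeasurable_comp₂ hB.aestronglyMeasurable hf

lemma integrable_sigmaDot_coulomb {f : Space → Spinor} (hf : AEStronglyMeasurable f) {x : Space}
    (h : ∫⁻ y, riesz 2 (x - y) * ‖f y‖ₑ < ⊤) :
    Integrable (fun y => sigmaDot (coulomb (x - y)) (f y)) := by
  refine ⟨aestronglyMeasurable_sigmaDot (by fun_prop) hf, ?_⟩
  simpa [HasFiniteIntegral, enorm_sigmaDot, enorm_coulomb] using h

/-- Dominated convergence under the untruncated kernel. The filter keeps `L ≥ 1`, where the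
truncation is known to be smooth and hence measurable. -/
lemma tendsto_integral_annular {f : Space → Spinor} (hf : AEStronglyMeasurable f) {x : Space}
    (h : ∫⁻ y, riesz 2 (x - y) * ‖f y‖ₑ < ⊤) :
    Tendsto (fun L => ∫ y, annular L (‖x - y‖ ^ 2) • sigmaDot (x - y) (f y)) (atTop ⊓ 𝓟 (Set.Ici 1))
      (𝓝 (∫ y, sigmaDot (coulomb (x - y)) (f y))) := by
  refine tendsto_integral_filter_of_dominated_convergence
    (fun y => ‖sigmaDot (coulomb (x - y)) (f y)‖) ?_ ?_ (integrable_sigmaDot_coulomb hf h).norm ?_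
  · filter_upwards [eventually_inf_principal.2 (.of_forall fun L hL => hL)] with L hL
    have hc := (contDiff_annular hL).continuous
    have hm : AEStronglyMeasurable (fun y : Space => annular L (‖x - y‖ ^ 2)) :=
      Continuous.aestronglyMeasurable (by fun_prop)
    exact hm.smul (aestronglyMeasurable_sigmaDot (B := fun y => x - y) (by fun_prop) hf)
  · refine .of_forall fun L => .of_forall fun y => ?_
    have h1 := abs_annular_le L (‖x - y‖ ^ 2)
    rw [Real.sqrt_sq (norm_nonneg _)] at h1
    rw [norm_smul, norm_sigmaDot, norm_sigmaDot, coulomb, norm_smul, norm_inv, norm_pow, norm_norm,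
      mul_assoc, Real.norm_eq_abs]
    gcongr
  · refine (ae_ne_space x).mono fun y hy => ?_
    have hd : 0 < ‖x - y‖ := norm_pos_iff.2 (sub_ne_zero.2 hy)
    have h1 := tendsto_annular (show 0 < ‖x - y‖ ^ 2 by positivity)
    rw [Real.sqrt_sq (norm_nonneg _)] at h1
    have h2 := (h1.smul_const (sigmaDot (x - y) (f y))).mono_left
      (inf_le_left : atTop ⊓ 𝓟 (Set.Ici (1 : ℝ)) ≤ atTop)
    simpa [coulomb] using h2

lemma support_mollifier_subset (x : Space) {r : ℝ} (hr : 0 < r) :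
    Function.support (fun y => mollifier (2 / r ^ 2) (x - y)) ⊆ Metric.closedBall x r := by
  intro y hy
  by_contra h
  rw [Metric.mem_closedBall, dist_eq_norm, norm_sub_rev, not_le] at h
  exact hy (mollifier_of_lt_norm hr h)

lemma volume_real_closedBall (x : Space) {r : ℝ} (hr : 0 < r) :
    volume.real (Metric.closedBall x r) = r ^ 3 * (Real.pi * 4 / 3) := by
  rw [measureReal_def, EuclideanSpace.volume_closedBall_fin_three, ENNReal.toReal_mul,
    ENNReal.toReal_pow, ENNReal.toReal_ofReal hr.le, ENNReal.toReal_ofReal (by positivity)]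

/-- Mollification converges almost everywhere as the scale tends to `0`. -/
lemma ae_tendsto_mollifier {ψ : Space → Spinor} (hψ : LocallyIntegrable ψ) :
    ∀ᵐ x, Tendsto (fun r : ℝ => ∫ y, mollifier (2 / r ^ 2) (x - y) • ψ y) (𝓝[>] 0)
      (𝓝 (ψ x)) := by
  obtain ⟨B, hB, h⟩ := exists_abs_mollifier_le
  filter_upwards [(Besicovitch.vitaliFamily volume).ae_tendsto_average_norm_sub hψ] with x hx
  refine tendsto_integral_smul_of_tendsto_average_norm_sub (a := fun r => Metric.closedBall x r)
    (B * (Real.pi * 4 / 3)) (hx.comp (Besicovitch.tendsto_filterAt volume x)) ?_ ?_ ?_ ?_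
  · exact .of_forall fun r => hψ.integrableOn_isCompact (isCompact_closedBall _ _)
  · refine tendsto_const_nhds.congr' ?_
    filter_upwards [self_mem_nhdsWithin] with r hr
    have hr' : (0 : ℝ) < r := hr
    rw [integral_sub_left_eq_self (fun z => mollifier (2 / r ^ 2) z),
      integral_mollifier (by positivity)]
  · filter_upwards [self_mem_nhdsWithin] with r hr using support_mollifier_subset x hr
  · filter_upwards [self_mem_nhdsWithin] with r hr y
    have hr' : (0 : ℝ) < r := hr
    rw [volume_real_closedBall x hr, mul_div_mul_right _ _ (by positivity)]
    exact h r hr _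

/-- Mollification of a square-integrable function vanishes as the scale tends to `∞`. -/
lemma tendsto_mollifier_atTop {ψ : Space → Spinor} (hψ2 : Integrable (fun y => ‖ψ y‖ ^ 2)) (x : Space) :
    Tendsto (fun r : ℝ => ∫ y, mollifier (2 / r ^ 2) (x - y) • ψ y) atTop (𝓝 0) := by
  obtain ⟨B, hB, h⟩ := exists_abs_mollifier_le
  set V := ∫ y, ‖ψ y‖ ^ 2
  have hlim : Tendsto (fun r : ℝ => B * (Real.pi * 4 / 3) * r⁻¹ + B * V * r⁻¹ ^ 2) atTop (𝓝 0) := by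
    have h1 := tendsto_inv_atTop_zero (𝕜 := ℝ)
    simpa using (h1.const_mul (B * (Real.pi * 4 / 3))).add ((h1.pow 2).const_mul (B * V))
  refine squeeze_zero_norm' ?_ hlim
  filter_upwards [eventually_gt_atTop 0] with r hr
  have h1 : ∫ y, mollifier (2 / r ^ 2) (x - y) • ψ y =
      ∫ y in Metric.closedBall x r, mollifier (2 / r ^ 2) (x - y) • ψ y := by
    refine (setIntegral_eq_integral_of_forall_compl_eq_zero fun y hy => ?_).symm
    have : mollifier (2 / r ^ 2) (x - y) = 0 := by
      by_contra h0
      exact hy (support_mollifier_subset x hr h0)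
    rw [this, zero_smul]
  have hc : IntegrableOn (fun _ : Space => r⁻¹) (Metric.closedBall x r) :=
    continuous_const.continuousOn.integrableOn_compact (isCompact_closedBall _ _)
  have hψr : IntegrableOn (fun y => r * ‖ψ y‖ ^ 2) (Metric.closedBall x r) :=
    (hψ2.const_mul r).integrableOn
  rw [h1]
  calc ‖∫ y in Metric.closedBall x r, mollifier (2 / r ^ 2) (x - y) • ψ y‖
      ≤ ∫ y in Metric.closedBall x r, B / r ^ 3 * (r⁻¹ + r * ‖ψ y‖ ^ 2) := by
        refine norm_integral_le_of_norm_le ((hc.add hψr).const_mul _) (.of_forall fun y => ?_)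
        rw [norm_smul]
        -- Young's inequality, balanced in `r` so that both the ball's volume `r³` and the `L²` mass
        -- are beaten by the factor `r⁻³`.
        have h2 : ‖ψ y‖ ≤ r⁻¹ + r * ‖ψ y‖ ^ 2 := by
          have h3 : r⁻¹ + r * ‖ψ y‖ ^ 2 - ‖ψ y‖ =
            r * ((‖ψ y‖ - r⁻¹ / 2) ^ 2 + 3 / 4 * r⁻¹ ^ 2) := by field_simp; ring
          have : 0 ≤ r * ((‖ψ y‖ - r⁻¹ / 2) ^ 2 + 3 / 4 * r⁻¹ ^ 2) := by positivity
          linarith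
        exact mul_le_mul (h r hr _) h2 (norm_nonneg _) (by positivity)
    _ = B / r ^ 3 * (r ^ 3 * (Real.pi * 4 / 3) * r⁻¹ +
          r * ∫ y in Metric.closedBall x r, ‖ψ y‖ ^ 2) := by
        rw [integral_const_mul, integral_add hc hψr, integral_const_mul, setIntegral_const,
          volume_real_closedBall x hr, smul_eq_mul]
    _ ≤ B / r ^ 3 * (r ^ 3 * (Real.pi * 4 / 3) * r⁻¹ + r * V) := by
        gcongr
        exact setIntegral_le_integral hψ2 (.of_forall fun y => by positivity)
    _ = _ := by field_simp

/-- A zero mode is the Coulomb potential of its source. -/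
lemma IsZeroMode.ae_eq_integral {A : Space → Space} (hA : AEMeasurable A)
    {ψ : Lp Spinor 2 (volume : Measure Space)} (hψ : IsZeroMode A ψ)
    (hfin : ∀ᵐ x : Space, ∫⁻ y, riesz 2 (x - y) * ‖sigmaDot (A y) (ψ y)‖ₑ < ⊤) :
    ∀ᵐ x, ψ x = (Complex.I / (4 * Real.pi)) •
      ∫ y, sigmaDot (coulomb (x - y)) (sigmaDot (A y) (ψ y)) := by
  have hloc : LocallyIntegrable ψ volume := (Lp.memLp ψ).locallyIntegrable (by norm_num)
  have hsq : Integrable (fun y => ‖ψ y‖ ^ 2) :=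
    (memLp_two_iff_integrable_sq_norm (Lp.aestronglyMeasurable ψ)).1 (Lp.memLp ψ)
  have hf := aestronglyMeasurable_sigmaDot hA (Lp.aestronglyMeasurable ψ)
  have hr_sq : Tendsto (fun r : ℝ => 2 / r ^ 2) (𝓝[>] 0) (atTop ⊓ 𝓟 (Set.Ici 1)) := by
    have h1 : Tendsto (fun r : ℝ => 2 / r ^ 2) (𝓝[>] 0) atTop := by
      simpa [div_eq_mul_inv] using ((tendsto_pow_atTop two_ne_zero).comp
        (tendsto_inv_nhdsGT_zero (𝕜 := ℝ))).const_mul_atTop two_pos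
    exact tendsto_inf.2 ⟨h1, tendsto_principal.2 (h1.eventually_ge_atTop 1)⟩
  -- With `L = 2/r²`, the wide mollifier at `L⁻¹ = 2/(2/r)²` has radius `2/r`.
  have hr_inv : Tendsto (fun r : ℝ => 2 / r) (𝓝[>] 0) atTop := by
    simpa [div_eq_mul_inv] using (tendsto_inv_nhdsGT_zero (𝕜 := ℝ)).const_mul_atTop two_pos
  filter_upwards [hfin, ae_tendsto_mollifier hloc] with x hx hmol
  have h1 := ((tendsto_integral_annular hf hx).comp hr_sq).const_smul
    (Complex.I / (4 * Real.pi))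
  have h2 := hmol.sub ((tendsto_mollifier_atTop hsq x).comp hr_inv)
  rw [sub_zero] at h2
  refine tendsto_nhds_unique h2 (h1.congr' ?_)
  filter_upwards [self_mem_nhdsWithin, hr_sq.eventually
    (eventually_inf_principal.2 (.of_forall fun L hL => hL))] with r hr hL
  have hr' : (0 : ℝ) < r := hr
  have hL' : (1 : ℝ) ≤ 2 / r ^ 2 := hL
  have hint : ∀ s : ℝ, 0 < s → Integrable (fun y => mollifier (2 / s ^ 2) (x - y) • ψ y) := by
    intro s hs
    refine hloc.integrable_smul_left_of_hasCompactSupport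
      ((continuous_mollifier _).comp (continuous_const.sub continuous_id)) ?_
    exact HasCompactSupport.of_support_subset_isCompact (isCompact_closedBall x s)
      (support_mollifier_subset x hs)
  have h3 := integral_radial_smul_sigmaDot hψ (contDiff_annular hL')
    (fun t ht => annular_of_large hL' ht) x
  simp_rw [divergence_annular hL', mul_smul, integral_smul] at h3
  have h4 : (2 / r ^ 2)⁻¹ = 2 / (2 / r) ^ 2 := by field_simp
  simp only [Function.comp_apply]
  rw [← integral_sub (hint r hr') (hint (2 / r) (by positivity)), div_eq_inv_mul, mul_smul, h3]
  simp_rw [sub_smul, h4]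
  have hpi : (Real.pi : ℂ) ≠ 0 := by exact_mod_cast Real.pi_ne_zero
  rw [← Complex.coe_smul, ← Complex.coe_smul, smul_smul, smul_smul]
  convert one_smul ℂ _ using 2
  push_cast
  field_simp

/-! ### Continuity and asymptotics of Coulomb potentials. -/

/-- The field is `|z|⁻¹` times the inversion `z/|z|²`, and inversion satisfies `|z/|z|² - w/|w|²| =
|z-w|/(|z||w|)`. -/
lemma norm_coulomb_sub_le {z w : Space} (hz : z ≠ 0) (hw : w ≠ 0) :
    ‖coulomb z - coulomb w‖ ≤ ‖z - w‖ * (‖z‖⁻¹ ^ 2 * ‖w‖⁻¹ + ‖w‖⁻¹ ^ 2 * ‖z‖⁻¹) := by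
  have hz' : 0 < ‖z‖ := norm_pos_iff.2 hz
  have hw' : 0 < ‖w‖ := norm_pos_iff.2 hw
  have h1 := EuclideanGeometry.dist_inversion_inversion hz hw 1
  simp only [EuclideanGeometry.inversion, dist_eq_norm, vsub_eq_sub, vadd_eq_add, sub_zero,
    add_zero] at h1
  have h2 : coulomb z - coulomb w = ‖z‖⁻¹ • ((1 / ‖z‖) ^ 2 • z - (1 / ‖w‖) ^ 2 • w) +
      (‖z‖⁻¹ - ‖w‖⁻¹) • ((1 / ‖w‖) ^ 2 • w) := by
    rw [coulomb, coulomb]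
    module
  have h3 : |‖z‖⁻¹ - ‖w‖⁻¹| ≤ ‖z - w‖ * (‖z‖⁻¹ * ‖w‖⁻¹) := by
    have : ‖z‖⁻¹ - ‖w‖⁻¹ = (‖w‖ - ‖z‖) * (‖z‖⁻¹ * ‖w‖⁻¹) := by field_simp
    rw [this, abs_mul, abs_of_nonneg (show 0 ≤ ‖z‖⁻¹ * ‖w‖⁻¹ by positivity), norm_sub_rev]
    gcongr
    exact abs_norm_sub_norm_le w z
  rw [h2]
  refine (norm_add_le _ _).trans ?_
  rw [norm_smul, h1, norm_smul, norm_smul, Real.norm_eq_abs, Real.norm_eq_abs,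
    abs_of_pos (inv_pos.2 hz'), norm_pow, norm_div, norm_one, norm_norm]
  calc _ ≤ ‖z‖⁻¹ * (1 ^ 2 / (‖z‖ * ‖w‖) * ‖z - w‖) +
        ‖z - w‖ * (‖z‖⁻¹ * ‖w‖⁻¹) * ((1 / ‖w‖) ^ 2 * ‖w‖) := by gcongr
    _ = _ := by field_simp

lemma norm_coulomb_eq_inv_sq (z : Space) : ‖coulomb z‖ = ‖z‖⁻¹ ^ 2 := by
  rw [norm_coulomb, inv_pow, Real.rpow_neg (norm_nonneg z)]
  norm_cast

/-- Geometric mean of the Lipschitz bound, of order `|z|⁻³`, and the trivial one, of order `|z|⁻²`: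
the exponent `5/2` is still locally integrable in dimension three, while `3` is not. -/
lemma enorm_coulomb_sub_le {z w : Space} (hz : z ≠ 0) (hw : w ≠ 0) :
    ‖coulomb z - coulomb w‖ₑ ≤
      2 * ‖z - w‖ₑ ^ (1 / 2 : ℝ) * (riesz (5 / 2) z + riesz (5 / 2) w) := by
  have hz' : 0 < ‖z‖ := norm_pos_iff.2 hz
  have hw' : 0 < ‖w‖ := norm_pos_iff.2 hw
  set d := ‖coulomb z - coulomb w‖ with hd
  set p := ‖z‖⁻¹ with hp
  set q := ‖w‖⁻¹ with hq
  have hp0 : 0 < p := inv_pos.2 hz'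
  have hq0 : 0 < q := inv_pos.2 hw'
  have hd0 : 0 ≤ d := norm_nonneg _
  have h1 : d ≤ ‖z - w‖ * (p ^ 2 * q + q ^ 2 * p) := norm_coulomb_sub_le hz hw
  have h2 : d ≤ p ^ 2 + q ^ 2 := by
    refine (norm_sub_le _ _).trans_eq ?_
    rw [norm_coulomb_eq_inv_sq, norm_coulomb_eq_inv_sq]
  have key : ∀ m : ℝ, p ≤ m → q ≤ m → d ≤ 2 * ‖z - w‖ ^ (1 / 2 : ℝ) * m ^ (5 / 2 : ℝ) := by
    intro m hpm hqm
    have hm : 0 < m := hp0.trans_le hpm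
    have h3 : d ≤ ‖z - w‖ * (2 * m ^ 3) := by
      refine h1.trans (mul_le_mul_of_nonneg_left ?_ (norm_nonneg _))
      calc p ^ 2 * q + q ^ 2 * p ≤ m ^ 2 * m + m ^ 2 * m := by gcongr
        _ = _ := by ring
    have h4 : d ≤ 2 * m ^ 2 := by
      refine h2.trans ?_
      calc p ^ 2 + q ^ 2 ≤ m ^ 2 + m ^ 2 := by gcongr
        _ = _ := by ring
    refine le_of_sq_le_sq ?_ (by positivity)
    have h5 : (‖z - w‖ ^ (1 / 2 : ℝ)) ^ 2 = ‖z - w‖ := by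
      rw [← Real.rpow_natCast, ← Real.rpow_mul (norm_nonneg _)]; norm_num
    have h6 : (m ^ (5 / 2 : ℝ)) ^ 2 = m ^ 5 := by
      rw [← Real.rpow_natCast, ← Real.rpow_mul hm.le, ← Real.rpow_natCast]; norm_num
    rw [mul_pow, mul_pow, h5, h6, pow_two d]
    calc d * d ≤ ‖z - w‖ * (2 * m ^ 3) * (2 * m ^ 2) := by gcongr
      _ = _ := by ring
  have hr : ∀ z : Space, 0 < ‖z‖ → riesz (5 / 2) z = ENNReal.ofReal (‖z‖⁻¹ ^ (5 / 2 : ℝ)) := by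
    intro z hz
    rw [riesz, Real.rpow_neg hz.le, Real.inv_rpow hz.le]
  rw [hr z hz', hr w hw', ← ofReal_norm, ← ofReal_norm, ENNReal.ofReal_rpow_of_nonneg
    (norm_nonneg _) (by norm_num), ← ENNReal.ofReal_add (by positivity) (by positivity)]
  have h2' : ENNReal.ofReal (2 * ‖z - w‖ ^ (1 / 2 : ℝ) * (p ^ (5 / 2 : ℝ) + q ^ (5 / 2 : ℝ))) =
      2 * ENNReal.ofReal (‖z - w‖ ^ (1 / 2 : ℝ)) *
        ENNReal.ofReal (p ^ (5 / 2 : ℝ) + q ^ (5 / 2 : ℝ)) := by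
    rw [ENNReal.ofReal_mul (by positivity), ENNReal.ofReal_mul two_pos.le, ENNReal.ofReal_ofNat]
  refine (ENNReal.ofReal_le_ofReal ?_).trans_eq h2'
  have hn : 0 ≤ 2 * ‖z - w‖ ^ (1 / 2 : ℝ) := by positivity
  rcases le_total p q with h | h
  · refine (key q h le_rfl).trans (mul_le_mul_of_nonneg_left ?_ hn)
    linarith [Real.rpow_nonneg hp0.le (5 / 2)]
  · refine (key p le_rfl h).trans (mul_le_mul_of_nonneg_left ?_ hn)
    linarith [Real.rpow_nonneg hq0.le (5 / 2)]

/-- Since `ω = r² coulomb (rω)`, the difference estimate applies when `|y| ≤ r`; otherwise the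
triangle inequality suffices, as `(|y|/r)^δ ≥ 1`. A small `δ` costs little of the source's decay. -/
lemma norm_sq_smul_coulomb_sub_le {r δ : ℝ} (hr : 0 < r) (hδ : 0 < δ) (hδ1 : δ ≤ 1)
    {ω y : Space} (hω : ‖ω‖ = 1) (hy : r • ω ≠ y) :
    ‖r ^ 2 • coulomb (r • ω - y) - ω‖ ≤
      2 * (‖y‖ / r) ^ δ * (r ^ 2 * ‖r • ω - y‖ ^ (-2 : ℝ) + 1) := by
  set z := r • ω - y with hz_def
  have hz : z ≠ 0 := sub_ne_zero.2 hy
  have hrω : ‖r • ω‖ = r := by rw [norm_smul, hω, mul_one, Real.norm_of_nonneg hr.le]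
  have hw : r • ω ≠ 0 := norm_pos_iff.1 (hrω.symm ▸ hr)
  have hω' : ω = r ^ 2 • coulomb (r • ω) := by
    rw [coulomb, hrω, smul_smul, smul_smul]
    convert (one_smul ℝ ω).symm using 2
    field_simp
  have hzw : ‖z - r • ω‖ = ‖y‖ := by rw [hz_def, sub_sub_cancel_left, norm_neg]
  have h1 := norm_coulomb_sub_le hz hw
  rw [hzw, hrω] at h1
  rw [← norm_coulomb, norm_coulomb_eq_inv_sq]
  set p := ‖z‖⁻¹ with hp
  have hp0 : 0 < p := inv_pos.2 (norm_pos_iff.2 hz)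
  have heq : ‖r ^ 2 • coulomb z - ω‖ = r ^ 2 * ‖coulomb z - coulomb (r • ω)‖ := by
    have h3 : r ^ 2 • coulomb z - ω = r ^ 2 • (coulomb z - coulomb (r • ω)) := by
      rw [smul_sub, ← hω']
    rw [h3, norm_smul, norm_pow, Real.norm_of_nonneg hr.le]
  have h2 : ‖r ^ 2 • coulomb z - ω‖ ≤ r ^ 2 * p ^ 2 + 1 := by
    refine (norm_sub_le _ _).trans_eq ?_
    rw [norm_smul, norm_pow, Real.norm_of_nonneg hr.le, norm_coulomb_eq_inv_sq, hω]
  rcases le_total (‖y‖ / r) 1 with he | he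
  · have h3 : ‖y‖ / r ≤ (‖y‖ / r) ^ δ := by
      simpa using Real.rpow_le_rpow_of_exponent_ge' (by positivity) he hδ.le hδ1
    calc ‖r ^ 2 • coulomb z - ω‖ ≤ r ^ 2 * (‖y‖ * (p ^ 2 * r⁻¹ + r⁻¹ ^ 2 * p)) := by
          rw [heq]; gcongr
      _ = ‖y‖ / r * ((r * p) ^ 2 + r * p) := by field_simp
      _ ≤ (‖y‖ / r) ^ δ * (2 * (r ^ 2 * p ^ 2 + 1)) := by
          refine mul_le_mul h3 ?_ (by positivity) (by positivity)
          nlinarith [sq_nonneg (r * p - 1)]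
      _ = _ := by ring
  · have h3 : 1 ≤ (‖y‖ / r) ^ δ := Real.one_le_rpow he hδ.le
    refine h2.trans (le_mul_of_one_le_left (by positivity) (by linarith))

section Potential

variable {f : Space → Spinor} {b : ℝ} {M : ℝ≥0}

lemma integrable_of_enorm_le_weight (hf : AEStronglyMeasurable f) (hb : 3 < b)
    (hfb : ∀ᵐ y, ‖f y‖ₑ ≤ M * weight b y) : Integrable f := by
  refine ⟨hf, (lintegral_mono_ae hfb).trans_lt ?_⟩
  rw [lintegral_const_mul _ (by fun_prop)]
  exact ENNReal.mul_lt_top (by simp) (lintegral_weight_lt_top hb)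

lemma lintegral_riesz_mul_enorm_le (a : ℝ) (hfb : ∀ᵐ y, ‖f y‖ₑ ≤ M * weight b y) (x : Space) :
    ∫⁻ y, riesz a (x - y) * ‖f y‖ₑ ≤ M * ∫⁻ y, riesz a (x - y) * weight b y := by
  rw [← lintegral_const_mul _ (by fun_prop)]
  refine lintegral_mono_ae (hfb.mono fun y hy => ?_)
  calc _ ≤ riesz a (x - y) * (M * weight b y) := by gcongr
    _ = _ := by ring

lemma integrable_coulomb_of_enorm_le_weight (hf : AEStronglyMeasurable f) (hb : 3 < b)
    (hfb : ∀ᵐ y, ‖f y‖ₑ ≤ M * weight b y) (x : Space) :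
    Integrable (fun y => sigmaDot (coulomb (x - y)) (f y)) := by
  obtain ⟨K, hK⟩ := exists_lintegral_riesz_mul_weight_le (a := 2) (b := b) (by norm_num)
    (by norm_num) (by linarith) (by linarith)
  refine integrable_sigmaDot_coulomb hf ((lintegral_riesz_mul_enorm_le 2 hfb x).trans_lt ?_)
  exact ENNReal.mul_lt_top (by simp) ((hK x).trans_lt (by simp))

/-- The Coulomb potential of a rapidly decaying source is Hölder continuous. -/
lemma continuous_coulomb_potential (hf : AEStronglyMeasurable f) (hb : 3 < b)
    (hfb : ∀ᵐ y, ‖f y‖ₑ ≤ M * weight b y) :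
    Continuous fun x => ∫ y, sigmaDot (coulomb (x - y)) (f y) := by
  obtain ⟨K, hK⟩ := exists_lintegral_riesz_mul_weight_le (a := 5 / 2) (b := b) (by norm_num)
    (by norm_num) (by linarith) (by linarith)
  have hH : HolderWith (2 * (M * K + M * K)) (1 / 2)
      (fun x => ∫ y, sigmaDot (coulomb (x - y)) (f y)) := by
    intro x x'
    rw [edist_eq_enorm_sub, edist_eq_enorm_sub,
      ← integral_sub (integrable_coulomb_of_enorm_le_weight hf hb hfb x)
        (integrable_coulomb_of_enorm_le_weight hf hb hfb x')]
    calc _ ≤ ∫⁻ y, ‖sigmaDot (coulomb (x - y)) (f y) - sigmaDot (coulomb (x' - y)) (f y)‖ₑ :=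
          enorm_integral_le_lintegral_enorm _
      _ ≤ ∫⁻ y, 2 * ‖x - x'‖ₑ ^ (1 / 2 : ℝ) *
            (riesz (5 / 2) (x - y) * ‖f y‖ₑ + riesz (5 / 2) (x' - y) * ‖f y‖ₑ) := by
          refine lintegral_mono_ae ?_
          filter_upwards [ae_ne_space x, ae_ne_space x'] with y h1 h2
          rw [← sub_apply, ← map_sub, enorm_sigmaDot, ← add_mul, ← mul_assoc]
          have h3 := enorm_coulomb_sub_le (sub_ne_zero.2 h1) (sub_ne_zero.2 h2)
          rw [sub_sub_sub_cancel_right] at h3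
          gcongr
      _ ≤ 2 * ‖x - x'‖ₑ ^ (1 / 2 : ℝ) * (M * K + M * K) := by
          have hm := hf.enorm
          rw [lintegral_const_mul'' _ (by fun_prop), lintegral_add_left' (by fun_prop)]
          gcongr
          · exact (lintegral_riesz_mul_enorm_le _ hfb x).trans (by gcongr; exact hK x)
          · exact (lintegral_riesz_mul_enorm_le _ hfb x').trans (by gcongr; exact hK x')
      _ = _ := by
          push_cast
          ring
  exact hH.continuous (by norm_num)

/-- Leading asymptotics of the Coulomb potential at infinity, uniformly in the direction. -/
lemma tendstoUniformlyOn_coulomb_potential (hf : AEStronglyMeasurable f) (hb : 3 < b)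
    (hfb : ∀ᵐ y, ‖f y‖ₑ ≤ M * weight b y) :
    TendstoUniformlyOn
      (fun (r : ℝ) (ω : Space) => r ^ 2 • ∫ y, sigmaDot (coulomb (r • ω - y)) (f y))
      (fun ω => ∫ y, sigmaDot ω (f y)) atTop (Metric.sphere 0 1) := by
  -- At most half of the excess `b - 3` is spent, so `⟨y⟩^(δ-b)` stays integrable.
  set δ : ℝ := min 1 ((b - 3) / 2) with hδ
  have hδ0 : 0 < δ := lt_min one_pos (by linarith)
  have hδ1 : δ ≤ 1 := min_le_left _ _
  have hδb : 3 < b - δ := by linarith [min_le_right 1 ((b - 3) / 2)]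
  obtain ⟨K, hK⟩ := exists_lintegral_riesz_two_mul_weight_le (b := b - δ) (s := 2) (by norm_num)
    (by norm_num) (by linarith)
  set W : ℝ≥0 := (∫⁻ y, weight (b - δ) y).toNNReal with hW
  have hW' : ∫⁻ y, weight (b - δ) y = W :=
    (ENNReal.coe_toNNReal (lintegral_weight_lt_top hδb).ne).symm
  have hfi := integrable_of_enorm_le_weight hf hb hfb
  have hlim : Tendsto (fun r : ℝ => ENNReal.ofReal (2 * r ^ (-δ)) * (M * (K + W) : ℝ≥0))
      atTop (𝓝 0) := by
    have h1 := ENNReal.tendsto_ofReal ((tendsto_rpow_neg_atTop hδ0).const_mul 2)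
    rw [mul_zero, ENNReal.ofReal_zero] at h1
    simpa using ENNReal.Tendsto.mul_const (b := ((M * (K + W) : ℝ≥0) : ℝ≥0∞)) h1
      (Or.inr ENNReal.coe_ne_top)
  rw [EMetric.tendstoUniformlyOn_iff]
  intro ε hε
  filter_upwards [hlim.eventually_lt_const hε, eventually_gt_atTop 0] with r hrε hr ω hω
  have hω1 : ‖ω‖ = 1 := by simpa using hω
  refine lt_of_le_of_lt ?_ hrε
  have hI : Integrable fun y => r ^ 2 • sigmaDot (coulomb (r • ω - y)) (f y) :=
    (integrable_coulomb_of_enorm_le_weight hf hb hfb _).smul (r ^ 2)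
  rw [edist_comm, edist_eq_enorm_sub, ← integral_smul, ← integral_sub hI
    ((sigmaDot ω).integrable_comp hfi)]
  refine (enorm_integral_le_lintegral_enorm _).trans ?_
  have hpt : ∀ᵐ y, ‖r ^ 2 • sigmaDot (coulomb (r • ω - y)) (f y) - sigmaDot ω (f y)‖ₑ ≤
      ENNReal.ofReal (2 * r ^ (-δ)) * (M * (ENNReal.ofReal (r ^ 2) *
        (riesz 2 (r • ω - y) * weight (b - δ) y) + weight (b - δ) y)) := by
    filter_upwards [hfb, ae_ne_space (r • ω)] with y hy hne
    have h1 : r ^ 2 • sigmaDot (coulomb (r • ω - y)) (f y) - sigmaDot ω (f y) =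
        sigmaDot (r ^ 2 • coulomb (r • ω - y) - ω) (f y) := by simp
    have h2 : ‖r ^ 2 • coulomb (r • ω - y) - ω‖ ≤ 2 * r ^ (-δ) * bracket y ^ (-(-δ)) *
        (r ^ 2 * ‖r • ω - y‖ ^ (-2 : ℝ) + 1) := by
      refine (norm_sq_smul_coulomb_sub_le hr hδ0 hδ1 hω1 hne).trans ?_
      rw [Real.div_rpow (norm_nonneg _) hr.le, neg_neg, Real.rpow_neg hr.le, mul_assoc 2 _⁻¹,
        ← div_eq_inv_mul]
      have := norm_le_bracket y
      gcongr
    have h3 : ‖r ^ 2 • coulomb (r • ω - y) - ω‖ₑ ≤ ENNReal.ofReal (2 * r ^ (-δ)) *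
        weight (-δ) y * (ENNReal.ofReal (r ^ 2) * riesz 2 (r • ω - y) + 1) := by
      rw [weight, riesz, ← ofReal_norm, ← ENNReal.ofReal_one, ← ENNReal.ofReal_mul (by positivity),
        ← ENNReal.ofReal_mul (by positivity), ← ENNReal.ofReal_add (by positivity) (by positivity),
        ← ENNReal.ofReal_mul (by have := bracket_pos y; positivity)]
      exact ENNReal.ofReal_le_ofReal h2
    rw [h1, enorm_sigmaDot]
    calc _ ≤ ENNReal.ofReal (2 * r ^ (-δ)) *
          weight (-δ) y * (ENNReal.ofReal (r ^ 2) * riesz 2 (r • ω - y) + 1) *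
            (M * weight b y) := by gcongr
      _ = ENNReal.ofReal (2 * r ^ (-δ)) * (M * (ENNReal.ofReal (r ^ 2) *
          (riesz 2 (r • ω - y) * (weight b y * weight (-δ) y)) +
            weight b y * weight (-δ) y)) := by ring
      _ = _ := by rw [weight_mul_weight, ← sub_eq_add_neg]
  refine (lintegral_mono_ae hpt).trans ?_
  rw [lintegral_const_mul _ (by fun_prop), lintegral_const_mul _ (by fun_prop),
    lintegral_add_right _ (by fun_prop), lintegral_const_mul _ (by fun_prop), hW']
  push_cast
  gcongr
  -- The factor `r²` is absorbed by the potential's decay `⟨rω⟩⁻²`, uniformly in `ω`.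
  have h4 : ENNReal.ofReal (r ^ 2) * weight 2 (r • ω) ≤ 1 := by
    rw [weight, ← ENNReal.ofReal_mul (by positivity), ENNReal.ofReal_le_one,
      Real.rpow_neg (bracket_pos _).le]
    norm_cast
    rw [bracket_sq, norm_smul, hω1, mul_one, Real.norm_of_nonneg hr.le, ← div_eq_mul_inv,
      div_le_one (by positivity)]
    linarith
  calc _ ≤ ENNReal.ofReal (r ^ 2) * (K * weight 2 (r • ω)) := by gcongr; exact hK _
    _ = K * (ENNReal.ofReal (r ^ 2) * weight 2 (r • ω)) := by ring
    _ ≤ K * 1 := by gcongr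
    _ = K := mul_one _

end Potential

/-! ### Decay of the source and the theorem. -/

lemma enorm_sigmaDot_le_of_norm_le {A : Space → Space} {C ρ : ℝ}
    (hA : ∀ x, ‖A x‖ ≤ C * bracket x ^ (-ρ)) (y : Space) (w : Spinor) :
    ‖sigmaDot (A y) w‖ₑ ≤ C.toNNReal * (weight ρ y * ‖w‖ₑ) := by
  rw [enorm_sigmaDot, ← mul_assoc]
  gcongr
  rw [← ofReal_norm]
  refine (ENNReal.ofReal_le_ofReal (hA y)).trans_eq ?_
  rw [ENNReal.ofReal_mul' (Real.rpow_nonneg (bracket_pos y).le _)]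
  rfl

lemma lintegral_enorm_mul_self_lt_top (ψ : Lp Spinor 2 (volume : Measure Space)) :
    ∫⁻ y, ‖ψ y‖ₑ * ‖ψ y‖ₑ < ⊤ := by
  have h := ((memLp_two_iff_integrable_sq_norm (Lp.aestronglyMeasurable ψ)).1
    (Lp.memLp ψ)).lintegral_lt_top
  refine lt_of_eq_of_lt (lintegral_congr fun y => ?_) h
  rw [ENNReal.ofReal_pow (norm_nonneg _), ofReal_norm, pow_two]

/-- A zero mode is the Coulomb potential of its source, which decays like `⟨y⟩⁻ᵖ⁻²`. -/
lemma IsZeroMode.source_decay {A : Space → Space} (hAmeas : AEMeasurable A) {C ρ : ℝ}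
    (hρ : 1 < ρ) (hA : ∀ x, ‖A x‖ ≤ C * bracket x ^ (-ρ))
    {ψ : Lp Spinor 2 (volume : Measure Space)} (hψ : IsZeroMode A ψ) :
    (∀ᵐ x, ψ x = (Complex.I / (4 * Real.pi)) •
      ∫ y, sigmaDot (coulomb (x - y)) (sigmaDot (A y) (ψ y))) ∧
    ∃ M : ℝ≥0, ∀ᵐ y, ‖sigmaDot (A y) (ψ y)‖ₑ ≤ M * weight (ρ + 2) y := by
  have hum : Measurable fun y => ‖ψ y‖ₑ := (Lp.stronglyMeasurable ψ).enorm
  have hu2 := lintegral_enorm_mul_self_lt_top ψ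
  have hle : ∀ x : Space, ∫⁻ y, riesz 2 (x - y) * ‖sigmaDot (A y) (ψ y)‖ₑ ≤
      C.toNNReal * ∫⁻ y, riesz 2 (x - y) * (weight ρ y * ‖ψ y‖ₑ) := by
    intro x
    rw [← lintegral_const_mul _ (by fun_prop)]
    refine lintegral_mono fun y => ?_
    calc _ ≤ riesz 2 (x - y) * (C.toNNReal * (weight ρ y * ‖ψ y‖ₑ)) := by
          gcongr; exact enorm_sigmaDot_le_of_norm_le hA y _
      _ = _ := by ring
  have hrep := hψ.ae_eq_integral hAmeas
    ((ae_lintegral_riesz_two_lt_top hum hu2 (b := ρ) (by linarith)).mono fun x hx =>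
      (hle x).trans_lt (ENNReal.mul_lt_top (by simp) hx))
  refine ⟨hrep, ?_⟩
  -- Taking norms in the representation makes `|ψ|` a subsolution.
  obtain ⟨M, hM⟩ := exists_ae_le_weight_two hum hu2 hρ
    (‖(Complex.I / (4 * Real.pi) : ℂ)‖₊ * C.toNNReal) <| hrep.mono fun x hx => by
      rw [hx, enorm_smul, ENNReal.coe_mul, mul_assoc]
      refine mul_le_mul_right ?_ _
      refine (enorm_integral_le_lintegral_enorm _).trans ?_
      simpa only [enorm_sigmaDot, enorm_coulomb] using hle x
  refine ⟨C.toNNReal * M, hM.mono fun y hy => ?_⟩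
  calc _ ≤ C.toNNReal * (weight ρ y * ‖ψ y‖ₑ) := enorm_sigmaDot_le_of_norm_le hA y _
    _ ≤ C.toNNReal * (weight ρ y * (M * weight 2 y)) := by gcongr
    _ = _ := by rw [← weight_mul_weight]; push_cast; ring

end WeylDirac

end

theorem mainTheorem3
    (A : WeylDirac.Space → WeylDirac.Space) (hAmeas : AEMeasurable A volume)
    (C ρ : ℝ) (hC : 0 < C) (hρ : 1 < ρ)
    (hA : ∀ x, ‖A x‖ ≤ C * WeylDirac.bracket x ^ (-ρ))
    (ψ : Lp WeylDirac.Spinor 2 (volume : Measure WeylDirac.Space))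
    (hψ : WeylDirac.IsZeroMode A ψ) :
    ∃ φ : WeylDirac.Space → WeylDirac.Spinor,
      Continuous φ ∧ φ =ᵐ[volume] ψ ∧
      (∀ ω ∈ Metric.sphere (0 : WeylDirac.Space) 1,
        Integrable (fun y => WeylDirac.act (WeylDirac.limitMatrix ω (A y)) (φ y)) volume) ∧
      TendstoUniformlyOn
        (fun (r : ℝ) (ω : WeylDirac.Space) => r ^ 2 • φ (r • ω))
        (fun ω => (Complex.I / (4 * Real.pi)) •
          ∫ y, WeylDirac.act (WeylDirac.limitMatrix ω (A y)) (φ y))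
        atTop (Metric.sphere (0 : WeylDirac.Space) 1) := by
  obtain ⟨hrep, M, hM⟩ := hψ.source_decay hAmeas hρ hA
  have hb : 3 < ρ + 2 := by linarith
  have hf := WeylDirac.aestronglyMeasurable_sigmaDot hAmeas (Lp.aestronglyMeasurable ψ)
  set T : WeylDirac.Space → WeylDirac.Spinor := fun x =>
    ∫ y, WeylDirac.sigmaDot (WeylDirac.coulomb (x - y)) (WeylDirac.sigmaDot (A y) (ψ y)) with hT
  -- The continuous representative is the potential itself, defined at every point.
  set φ : WeylDirac.Space → WeylDirac.Spinor := fun x => (Complex.I / (4 * Real.pi)) • T x with hφ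
  have hφψ : φ =ᵐ[volume] ψ := hrep.mono fun x hx => hx.symm
  have hlim : ∀ ω : WeylDirac.Space,
      (fun y => WeylDirac.act (WeylDirac.limitMatrix ω (A y)) (φ y)) =ᵐ[volume]
        fun y => WeylDirac.sigmaDot ω (WeylDirac.sigmaDot (A y) (ψ y)) := fun ω =>
    hφψ.mono fun y hy => by
      simp only []
      rw [WeylDirac.act_limitMatrix, hy]
  have hφc : Continuous φ :=
    (continuous_const_smul (Complex.I / (4 * Real.pi) : ℂ)).comp
      (WeylDirac.continuous_coulomb_potential hf hb hM)
  refine ⟨φ, hφc, hφψ,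
    fun ω _ => ?_, ?_⟩
  · exact ((WeylDirac.sigmaDot ω).integrable_comp
      (WeylDirac.integrable_of_enorm_le_weight hf hb hM)).congr (hlim ω).symm
  · have h := (uniformContinuous_const_smul (Complex.I / (4 * Real.pi) : ℂ)).comp_tendstoUniformlyOn
      (WeylDirac.tendstoUniformlyOn_coulomb_potential hf hb hM)
    refine (h.congr (.of_forall fun r ω _ => ?_)).congr_right fun ω _ => ?_
    · simp only [Function.comp_apply, hφ, hT]
      rw [smul_comm]
    · simp only [Function.comp_apply]
      rw [integral_congr_ae (hlim ω)]
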